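/- Let $f:[0,1)\to\mathbb{R}$ be a $C^{1+AC}$ function, i.e. $f$ is differentiable on $[0,1)$ (one-sidedly at $0$) and its derivative is absolutely continuous and of bounded variation on $[0,1)$. Assume that $\int_0^1 f(x)\,dx=0$ and that $f(0)=\lim_{x\to1^-}f(x)\neq 0$. For positive numbers $\lambda_A,\lambda_B,\lambda_C$ with $\lambda_A+\lambda_B+\lambda_C=1$ let $T=T_\lambda:[0,1)\to[0,1)$ be the symmetric 3-interval exchange transformation (3-IET) with permutation $\begin{pmatrix}A&B&C\\ C&B&A\end{pmatrix}$, that is, \[ T(x)=\begin{cases}x+\lambda_B+\lambda_C,&0\le x<\lambda_A,\\ x+\lambda_C-\lambda_A,&\lambda_A\le x<\lambda_A+\lambda_B,\\ x-\lambda_A-\lambda_B,&\lambda_A+\lambda_B\le x<1.\end{cases} \] Then for almost every symmetric 3-IET $T$, i.e. for almost every $\lambda=(\lambda_A,\lambda_B,\lambda_C)$ with respect to Lebesgue measure on the open unit simplex, the skew product $T_f:[0,1)\times\mathbb{R}\to[0,1)\times\mathbb{R}$, $T_f(x,t)=(Tx,\,t+f(x))$, is ergodic with respect to the product measure $\mathrm{Leb}_{[0,1)}\otimes\mathrm{Leb}_{\mathbb{R}}$.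 In particular, for almost every such $T$, $f$ is not a coboundary for $T$: there is no measurable function $g:[0,1)\to\mathbb{R}$ with $f=g\circ T-g$ almost everywhere. -/

import Mathlib

open MeasureTheory Set Filter Topology

noncomputable section

/-- The class `C^{1+AC}([0,1))`: `f` is differentiable on `[0,1)` (one-sidedly at `0`), and its
derivative `g` there is absolutely continuous (on every compact subinterval `[0,b]`, `b < 1`) and of
bounded variation on `[0,1)`. Given the bounded variation on all of `[0,1)`, absolute continuity
on compact subintervals is the same as absolute continuity on `[0,1)`.
Only the values of `f` on `[0,1)` matter. -/
def IsC1AC (f : ℝ → ℝ) : Prop :=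
  ∃ g : ℝ → ℝ,
    (∀ x ∈ Ico (0 : ℝ) 1, HasDerivWithinAt f (g x) (Ico (0 : ℝ) 1) x) ∧
    (∀ b ∈ Ico (0 : ℝ) 1, AbsolutelyContinuousOnInterval g 0 b) ∧
    BoundedVariationOn g (Ico (0 : ℝ) 1)

/-- The space of length data `(lA, lB, lC)` of positive numbers with `lA + lB + lC = 1`,
parametrized by the pair `(lA, lB)`, i.e. the open triangle in the plane. -/
def LengthSimplex : Set (ℝ × ℝ) := {p | 0 < p.1 ∧ 0 < p.2 ∧ p.1 + p.2 < 1}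

/-- Two-dimensional Lebesgue measure on the space of length data. -/
def lebSimplex : Measure LengthSimplex := Measure.comap Subtype.val (volume : Measure (ℝ × ℝ))

/-- Lebesgue measure on `[0,1)`. -/
def lebIco : Measure (Ico (0 : ℝ) 1) := Measure.comap Subtype.val (volume : Measure ℝ)

namespace LengthSimplex

/-- Length of the first interval `A`. -/
def lA (l : LengthSimplex) : ℝ := l.1.1

/-- Length of the middle interval `B`. -/
def lB (l : LengthSimplex) : ℝ := l.1.2

/-- Length of the last interval `C`. -/
def lC (l : LengthSimplex) : ℝ := 1 - l.1.1 - l.1.2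

theorem lA_pos (l : LengthSimplex) : 0 < lA l := l.2.1

theorem lB_pos (l : LengthSimplex) : 0 < lB l := l.2.2.1

theorem lC_pos (l : LengthSimplex) : 0 < lC l := by
  have h := l.2.2.2
  simp only [lC]
  linarith

theorem sum_eq_one (l : LengthSimplex) : lA l + lB l + lC l = 1 := by
  simp only [lA, lB, lC]
  ring

end LengthSimplex

open LengthSimplex in
/-- Formula of the interval exchange with permutation `(A B C / C B A)`: the intervals
`A = [0, lA)`, `B = [lA, lA + lB)`, `C = [lA + lB, 1)` are translated so that they appear in
the order `C, B, A`. -/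
def symIETFun (l : LengthSimplex) (x : ℝ) : ℝ :=
  if x < lA l then x + (lC l + lB l)
  else if x < lA l + lB l then x + lC l - lA l
  else x - (lA l + lB l)

theorem symIETFun_mem (l : LengthSimplex) {x : ℝ} (hx : x ∈ Ico (0 : ℝ) 1) :
    symIETFun l x ∈ Ico (0 : ℝ) 1 := by
  have hA := LengthSimplex.lA_pos l
  have hB := LengthSimplex.lB_pos l
  have hC := LengthSimplex.lC_pos l
  have hs := LengthSimplex.sum_eq_one l
  obtain ⟨h0, h1⟩ := hx
  unfold symIETFun
  split_ifs <;> constructor <;> linarith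

/-- The symmetric 3-IET `T : [0,1) → [0,1)` with length data `l`. -/
def symIET (l : LengthSimplex) (x : Ico (0 : ℝ) 1) : Ico (0 : ℝ) 1 :=
  ⟨symIETFun l x, symIETFun_mem l x.2⟩

/-- The skew product `T_f (x, t) = (T x, t + f x)` on `X × ℝ`. -/
def skewProduct {X : Type*} (T : X → X) (f : X → ℝ) (z : X × ℝ) : X × ℝ :=
  (T z.1, z.2 + f z.1)

/-- `f` is a (measurable) coboundary for `T` with respect to `μ`: `f = g ∘ T - g` almost everywhere
for some measurable real function `g`. No integrability or regularity of `g` is asked, so that not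
being a coboundary in this sense also excludes solutions `g` in `L¹` or smoother classes. -/
def IsCoboundary {X : Type*} [MeasurableSpace X] (T : X → X) (μ : Measure X) (f : X → ℝ) : Prop :=
  ∃ g : X → ℝ, AEMeasurable g μ ∧ ∀ᵐ x ∂μ, f x = g (T x) - g x

end

/-! The exchange is the first return map to `[0, 1)` of the rotation by `b = lB + lC` on a circle of
length `p = 1 + lB`: points of `B` pass once through `[1, p)` before returning. Extending `f` by
zero to `[1, p)` turns the problem into ergodicity of a skew product over this rotation
(`ergodic_skewProduct_symIET`).

Write the extension as `f 0` times the indicator of `[0, 1)` plus a function `G`. Since `f` has the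
same limit `f 0` at both ends, `G` is continuous, and its right derivative has bounded variation and
mean zero. Denjoy–Koksma bounds the Birkhoff sums of the derivative along good denominators `q`,
which forces those of `G` to be uniformly close to `q / p` times its integral, that is, to `-f 0 * q
/ p` (`birkhoffSum_smooth_tendsto`). The indicator contributes an integer `N` at bounded distance
from `q / p`. So the sums of the extension are close to `f 0 * (N - q / p)`
(`exists_int_birkhoffSum_extPeriodic`).

For almost every pair `(b / p, 1 / p)` the numbers `q / p`, over good denominators of `b / p`, are
dense modulo one (`ae_goodPair`). Taking `q / p` near `c` modulo one, the sums take nearly finitely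
many values `f 0 * (k - c)`, `k` an integer, and by pigeonhole some `k` occurs on a set of measure
bounded below, while `q` steps of the rotation are almost the identity. Such a value is a period of
every family invariant under the skew product (`SkewInvariant.mem_periods_of_frequently`). As `c`
ranges over the reals and `f 0 ≠ 0`, the group of periods is uncountable, hence dense. Thus the
local section measures of an invariant set are constant, and Lebesgue density makes the set null or
conull (`measure_eq_zero_or_compl_of_skewInvariant`). -/

open TopologicalSpace (denseSeq denseRange_denseSeq)

noncomputable section

/-! ### Denjoy–Koksma inequalities -/

/-- A sum of a `p`-periodic function over `x + j (m/q) p`, `j < q`, with `m` prime to `q`, is the sum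
over the equally spaced points `x + i p/q`. -/
theorem sum_periodic_of_coprime {Q : ℝ → ℝ} {p : ℝ} (hQ : Function.Periodic Q p) {q : ℕ}
    (hq : 0 < q) {m : ℤ} (hm : IsCoprime m (q : ℤ)) (x : ℝ) :
    ∑ j ∈ Finset.range q, Q (x + j * (m * p / q)) = ∑ i ∈ Finset.range q, Q (x + i * (p / q)) := by
  have : NeZero q := ⟨hq.ne'⟩
  have hq' : (q : ℝ) ≠ 0 := by positivity
  have hcong : ∀ a b : ℤ, (a : ZMod q) = b → Q (x + a * (p / q)) = Q (x + b * (p / q)) := by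
    intro a b hab
    obtain ⟨k, hk⟩ := (ZMod.intCast_eq_intCast_iff_dvd_sub a b q).1 hab
    have hb : (b : ℝ) = a + q * k := by
      have : b = a + q * k := by linarith
      exact_mod_cast this
    have : x + b * (p / q) = x + a * (p / q) + k * p := by
      rw [hb]; field_simp; ring
    rw [this, (hQ.int_mul k) _]
  have hu : IsUnit (m : ZMod q) := by
    have := hm.map (Int.castRingHom (ZMod q))
    simpa [isCoprime_zero_right] using this
  have key : ∀ R : ZMod q → ℝ, ∑ j ∈ Finset.range q, R (j : ZMod q) = ∑ z : ZMod q, R z := by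
    intro R
    refine Finset.sum_bij' (fun j _ => (j : ZMod q)) (fun z _ => z.val) ?_ ?_ ?_ ?_ ?_
    · simp
    · intro z _; simpa using ZMod.val_lt z
    · intro j hj; exact ZMod.val_cast_of_lt (Finset.mem_range.1 hj)
    · intro z _; simp
    · simp
  -- The summand depends only on the index modulo `q`, so it descends to `ZMod q`, where
  -- multiplication by the unit `m` is a permutation.
  set R : ZMod q → ℝ := fun z => Q (x + z.val * (p / q)) with hR
  have hRint : ∀ a : ℤ, R a = Q (x + a * (p / q)) := by
    intro a
    have := hcong ((a : ZMod q).val : ℤ) a (by simp)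
    simpa [hR] using this
  calc ∑ j ∈ Finset.range q, Q (x + j * (m * p / q))
      = ∑ j ∈ Finset.range q, (fun z => R (z * hu.unit)) (j : ZMod q) := by
        refine Finset.sum_congr rfl fun j _ => ?_
        have := hRint (j * m)
        push_cast at this
        simp only [IsUnit.unit_spec, this]
        congr 1; ring
    _ = ∑ z : ZMod q, R (z * hu.unit) := key (fun z => R (z * hu.unit))
    _ = ∑ z : ZMod q, R z := Equiv.sum_comp (Units.mulRight hu.unit) R
    _ = ∑ j ∈ Finset.range q, R (j : ZMod q) := (key R).symm
    _ = _ := by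
        refine Finset.sum_congr rfl fun j _ => ?_
        have := hRint j
        push_cast at this
        exact this

/-- Denjoy–Koksma inequality for a periodic function whose oscillation is controlled by
a function `U` that gains `V` over each period. -/
theorem denjoyKoksma {E U : ℝ → ℝ} {p V a : ℝ} (hp : 0 < p) (hE : Function.Periodic E p)
    (hi : IntervalIntegrable E volume 0 p)
    (hU : ∀ y z, z ≤ y → |E y - E z| ≤ U y - U z) (hV : ∀ y, U (y + p) = U y + V)
    {q : ℕ} (hq : 0 < q) {m : ℤ} (hm : IsCoprime m (q : ℤ)) (ha : |q * a - m * p| ≤ p / q) (x : ℝ) :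
    |∑ j ∈ Finset.range q, E (x + j * a) - q / p * ∫ y in (0 : ℝ)..p, E y| ≤ 2 * V := by
  have hq' : (0 : ℝ) < q := by positivity
  set r : ℝ := p / q with hr
  have hr0 : 0 < r := by positivity
  have hqr : q * r = p := by rw [hr]; field_simp
  have hmono : Monotone U := fun z y h => by have := (abs_nonneg _).trans (hU y z h); linarith
  have hii : ∀ s t, IntervalIntegrable E volume s t := fun s t =>
    hE.intervalIntegrable₀ hp.ne' hi s t
  -- The orbit point attached to `z` and the averaging interval `[z, z + r]` both lie in `[z - r, z
  -- + r]`, on which `E` oscillates by at most `W z`.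
  set W : ℝ → ℝ := fun z => U (z + r) - U (z - r) with hW
  set I : ℝ → ℝ := fun z => ∫ s in z..(z + r), E s with hI
  have hWp : Function.Periodic W p := by
    intro z
    have h1 : z + p + r = z + r + p := by ring
    have h2 : z + p - r = z - r + p := by ring
    simp only [hW, h1, h2, hV]; ring
  have hIp : Function.Periodic I p := by
    intro z
    have h1 : z + p + r = z + r + p := by ring
    simp only [hI, h1]
    rw [← intervalIntegral.integral_comp_add_right E p]
    exact intervalIntegral.integral_congr fun s _ => hE s
  have hsumI : ∑ j ∈ Finset.range q, I (x + j * (m * p / q)) = ∫ y in (0 : ℝ)..p, E y := by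
    rw [sum_periodic_of_coprime hIp hq hm, ← hr]
    have := intervalIntegral.sum_integral_adjacent_intervals (f := E) (μ := volume)
      (a := fun i : ℕ => x + i * r) (n := q) (fun k _ => hii _ _)
    simp only [hI]
    have e : ∀ i : ℕ, x + i * r + r = x + ((i + 1 : ℕ) : ℝ) * r := by intro i; push_cast; ring
    simp only [e]
    rw [this, hqr]
    simp only [Nat.cast_zero, zero_mul, add_zero]
    have := hE.intervalIntegral_add_eq x 0
    simpa using this
  have hsumW : ∑ j ∈ Finset.range q, W (x + j * (m * p / q)) = 2 * V := by
    rw [sum_periodic_of_coprime hWp hq hm, ← hr]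
    -- Each window of length `2 * r` is two adjacent steps of length `r`; the two telescoping sums
    -- each run over one full period and gain `V`.
    have e : ∀ i : ℕ, W (x + i * r) = (U (x + ((i + 1 : ℕ) : ℝ) * r) - U (x + (i : ℝ) * r)) +
        (U (x - r + ((i + 1 : ℕ) : ℝ) * r) - U (x - r + (i : ℝ) * r)) := by
      intro i
      have h1 : x + ((i + 1 : ℕ) : ℝ) * r = x + i * r + r := by push_cast; ring
      have h2 : x - r + ((i + 1 : ℕ) : ℝ) * r = x + i * r := by push_cast; ring
      have h3 : x - r + (i : ℝ) * r = x + i * r - r := by ring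
      simp only [hW, h1, h2, h3]; ring
    simp only [e]
    rw [Finset.sum_add_distrib, Finset.sum_range_sub (fun i : ℕ => U (x + (i : ℝ) * r)),
      Finset.sum_range_sub (fun i : ℕ => U (x - r + (i : ℝ) * r)), hqr, hV, hV]
    simp; ring
  have hterm : ∀ j ∈ Finset.range q, |E (x + j * a) - q / p * I (x + j * (m * p / q))| ≤
      W (x + j * (m * p / q)) := by
    intro j hj
    have hjq : (j : ℝ) ≤ q := by exact_mod_cast (Finset.mem_range.1 hj).le
    set z := x + j * (m * p / q) with hz
    set y := x + j * a with hy
    have hyz : |y - z| ≤ r := by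
      have : y - z = (j / q) * (q * a - m * p) := by rw [hy, hz]; field_simp; ring
      rw [this, abs_mul, abs_of_nonneg (by positivity)]
      calc (j / q : ℝ) * |q * a - m * p| ≤ 1 * (p / q) := by
            apply mul_le_mul _ ha (abs_nonneg _) zero_le_one
            rw [div_le_one hq']; exact hjq
        _ = r := by rw [one_mul]
    obtain ⟨hy1, hy2⟩ := abs_le.1 hyz
    have hqp : (q : ℝ) / p = r⁻¹ := by rw [hr, inv_div]
    have hint : E y - q / p * I z = r⁻¹ * ∫ s in z..(z + r), (E y - E s) := by
      rw [intervalIntegral.integral_sub (by simp) (hii _ _), intervalIntegral.integral_const, hqp]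
      simp only [add_sub_cancel_left, smul_eq_mul, mul_sub, hI]
      rw [inv_mul_cancel_left₀ hr0.ne']
    have hb : ‖∫ s in z..(z + r), (E y - E s)‖ ≤ W z * |z + r - z| := by
      apply intervalIntegral.norm_integral_le_of_norm_le_const
      intro s hs
      rw [uIoc_of_le (by linarith)] at hs
      rw [Real.norm_eq_abs]
      have hUy1 := hmono (show y ≤ z + r by linarith)
      have hUy2 := hmono (show z - r ≤ y by linarith)
      have hUs1 := hmono (show s ≤ z + r from hs.2)
      have hUs2 := hmono (show z - r ≤ s by linarith [hs.1])
      simp only [hW]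
      rcases le_total s y with h | h
      · have := hU y s h; linarith
      · have := hU s y h; rw [abs_sub_comm] at this; linarith
    rw [hint, abs_mul, abs_of_pos (inv_pos.2 hr0)]
    rw [Real.norm_eq_abs, add_sub_cancel_left, abs_of_pos hr0] at hb
    calc r⁻¹ * _ ≤ r⁻¹ * (W z * r) := by gcongr
      _ = W z := by field_simp
  rw [← hsumI, Finset.mul_sum, ← Finset.sum_sub_distrib, ← hsumW]
  exact (Finset.abs_sum_le_sum_abs _ _).trans (Finset.sum_le_sum hterm)

/-- Denjoy–Koksma inequality for the periodic extension of a bounded function on `[0, p)`. -/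
theorem denjoyKoksma_toIcoMod {E U : ℝ → ℝ} {p M C a : ℝ} (hp : 0 < p)
    (hi : IntervalIntegrable (fun y => E (toIcoMod hp 0 y)) volume 0 p)
    (hC : ∀ y ∈ Ico 0 p, |E y| ≤ C) (hM : ∀ y ∈ Ico 0 p, U y ∈ Icc 0 M)
    (hU : ∀ y ∈ Ico 0 p, ∀ z ∈ Ico 0 p, z ≤ y → |E y - E z| ≤ U y - U z)
    {q : ℕ} (hq : 0 < q) {m : ℤ} (hm : IsCoprime m (q : ℤ)) (ha : |q * a - m * p| ≤ p / q) (x : ℝ) :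
    |∑ j ∈ Finset.range q, E (toIcoMod hp 0 (x + j * a)) -
      q / p * ∫ y in (0 : ℝ)..p, E (toIcoMod hp 0 y)| ≤ 2 * (M + 2 * C) := by
  have hmem : ∀ y, toIcoMod hp 0 y ∈ Ico 0 p := fun y => by
    simpa using toIcoMod_mem_Ico hp 0 y
  have h0 : (0 : ℝ) ∈ Ico 0 p := ⟨le_rfl, hp⟩
  have hC0 : 0 ≤ C := (abs_nonneg _).trans (hC 0 h0)
  have hM0 : 0 ≤ M := (hM 0 h0).1.trans (hM 0 h0).2
  refine denjoyKoksma (E := fun y => E (toIcoMod hp 0 y))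
    -- Across a period boundary `U` may drop by `M` while `E` changes by up to `2 * C`; a gain of `M
    -- + 2 * C` per period pays for both.
    (U := fun y => toIcoDiv hp 0 y * (M + 2 * C) + U (toIcoMod hp 0 y)) hp
    (fun y => by simp) hi ?_ ?_ hq hm ha x
  · intro y z hzy
    have hy := hmem y
    have hz := hmem z
    have ey := toIcoMod_add_toIcoDiv_zsmul hp 0 y
    have ez := toIcoMod_add_toIcoDiv_zsmul hp 0 z
    simp only [zsmul_eq_mul] at ey ez
    have hle : toIcoDiv hp 0 z ≤ toIcoDiv hp 0 y := by
      by_contra hlt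
      have h1 : (toIcoDiv hp 0 y : ℝ) + 1 ≤ toIcoDiv hp 0 z := by exact_mod_cast not_le.1 hlt
      nlinarith [hy.2, hz.1]
    rcases hle.eq_or_lt with h | h
    · simp only [h]
      rw [h] at ez
      have := hU _ hy _ hz (by linarith)
      linarith
    · have h1 : (toIcoDiv hp 0 z : ℝ) + 1 ≤ toIcoDiv hp 0 y := by exact_mod_cast h
      have := mul_le_mul_of_nonneg_right h1 (show 0 ≤ M + 2 * C by positivity)
      have b1 := hM _ hy
      have b2 := hM _ hz
      have b3 := abs_sub (E (toIcoMod hp 0 y)) (E (toIcoMod hp 0 z))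
      have b4 := hC _ hy
      have b5 := hC _ hz
      linarith [b1.1, b2.2]
  · intro y
    simp only [toIcoDiv_add_right, toIcoMod_add_right]
    push_cast; ring

/-! ### Good denominators and Birkhoff sums of smooth functions -/

/-- `q` is a denominator of a reduced fraction `m / q` with `|a / p - m / q| ≤ 1 / q ^ 2`. -/
def GoodDenominator (p a : ℝ) (q : ℕ) : Prop :=
  0 < q ∧ ∃ m : ℤ, IsCoprime m (q : ℤ) ∧ |q * a - m * p| ≤ p / q

/-- If the Birkhoff sums of the right derivative of a periodic function are bounded along
the good denominators, then those of the function itself are asymptotically constant. -/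
theorem birkhoffSum_smooth_tendsto {G g : ℝ → ℝ} {p a L C : ℝ} (hp : 0 < p)
    (hG : Function.Periodic G p) (hcont : Continuous G)
    (hderiv : ∀ y, HasDerivWithinAt G (g y) (Ici y) y) (hL : ∀ y, |g y| ≤ L)
    (hC : ∀ n, GoodDenominator p a n → ∀ x, |∑ j ∈ Finset.range n, g (x + j * a)| ≤ C)
    (hinf : ∀ N, ∃ n ≥ N, GoodDenominator p a n) {ε : ℝ} (hε : 0 < ε) :
    ∃ Q, ∀ q ≥ Q, GoodDenominator p a q → ∀ x,
      |∑ j ∈ Finset.range q, G (x + j * a) - q / p * ∫ y in (0 : ℝ)..p, G y| ≤ ε := by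
  have hL0 : 0 ≤ L := (abs_nonneg _).trans (hL 0)
  have hC0 : 0 ≤ C := by
    obtain ⟨n, -, hn⟩ := hinf 0
    exact (abs_nonneg _).trans (hC n hn 0)
  have lip : ∀ (H h : ℝ → ℝ) (K : ℝ), Continuous H →
      (∀ y, HasDerivWithinAt H (h y) (Ici y) y) → (∀ y, |h y| ≤ K) →
      ∀ y z, z ≤ y → |H y - H z| ≤ K * y - K * z := by
    intro H h K hc hd hK y z hzy
    have := norm_image_sub_le_of_norm_deriv_right_le_segment (a := z) (b := y) hc.continuousOn
      (fun x _ => hd x) (fun x _ => hK x) y ⟨hzy, le_rfl⟩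
    rw [Real.norm_eq_abs] at this
    linarith
  obtain ⟨n, hnN, hn⟩ := hinf ⌈4 * C * p / ε⌉₊
  have hn0 : (0 : ℝ) < n := by exact_mod_cast hn.1
  have hnε : 2 * (C / n * p) ≤ ε / 2 := by
    have h1 : 4 * C * p / ε ≤ n := (Nat.le_ceil _).trans (by exact_mod_cast hnN)
    rw [div_le_iff₀ hε] at h1
    have h2 : 2 * (C / n * p) = 4 * C * p / n / 2 := by ring
    rw [h2]
    have : 4 * C * p / n ≤ ε := by rw [div_le_iff₀ hn0]; linarith
    linarith
  -- Averaging over `n` steps, `n` a fixed good denominator, divides the bound `C` on the derivative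
  -- sums by `n`. Thus `A` has small Lipschitz constant `C / n`, and Denjoy–Koksma for `A` has error
  -- at most `ε / 2`.
  set A : ℝ → ℝ := fun x => (n : ℝ)⁻¹ * ∑ i ∈ Finset.range n, G (x + i * a) with hA
  have hAc : Continuous A := by fun_prop
  have hAd : ∀ y, HasDerivWithinAt A ((n : ℝ)⁻¹ * ∑ i ∈ Finset.range n, g (y + i * a)) (Ici y) y := by
    intro y
    refine HasDerivWithinAt.const_mul _ (HasDerivWithinAt.fun_sum fun i _ => ?_)
    have h1 : HasDerivWithinAt (fun x : ℝ => x + i * a) 1 (Ici y) y :=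
      ((hasDerivAt_id y).add_const _).hasDerivWithinAt
    have := (hderiv (y + i * a)).comp y h1 (fun z hz => by
      simp only [mem_Ici] at hz ⊢; linarith)
    simpa [Function.comp_def] using this
  have hAp : Function.Periodic A p := by
    intro x
    simp only [hA]
    congr 1
    refine Finset.sum_congr rfl fun i _ => ?_
    rw [show x + p + i * a = x + i * a + p by ring, hG]
  have hAU := lip A _ (C / n) hAc hAd (fun y => by
    rw [abs_mul, abs_inv, abs_of_pos hn0, div_eq_inv_mul]
    gcongr
    exact hC n hn y)
  have hAint : ∫ y in (0 : ℝ)..p, A y = ∫ y in (0 : ℝ)..p, G y := by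
    simp only [hA]
    rw [intervalIntegral.integral_const_mul, intervalIntegral.integral_finsetSum
      (f := fun (i : ℕ) x => G (x + i * a))
      (fun i _ => (by fun_prop : Continuous fun x => G (x + i * a)).intervalIntegrable _ _)]
    have : ∀ i ∈ Finset.range n, ∫ x in (0 : ℝ)..p, G (x + i * a) = ∫ y in (0 : ℝ)..p, G y := by
      intro i _
      rw [intervalIntegral.integral_comp_add_right G]
      have := hG.intervalIntegral_add_eq (0 + i * a) 0
      rw [zero_add p] at this
      rw [← this]
      congr 1; ring
    rw [Finset.sum_congr rfl this]
    simp only [Finset.sum_const, Finset.card_range, nsmul_eq_mul]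
    field_simp
  have hGU := lip G g L hcont hderiv hL
  have hGlip : ∀ y z, |G y - G z| ≤ L * |y - z| := by
    intro y z
    rcases le_total z y with h | h
    · rw [abs_of_nonneg (sub_nonneg.2 h)]; linarith [hGU y z h]
    · rw [abs_sub_comm, abs_sub_comm y, abs_of_nonneg (sub_nonneg.2 h)]; linarith [hGU z y h]
  refine ⟨⌈2 * n * L * p / ε⌉₊, fun q hq hgood x => ?_⟩
  obtain ⟨hq0, m, hm, hqa⟩ := hgood
  have hq' : (0 : ℝ) < q := by exact_mod_cast hq0
  have hqε : n * (L * (p / q)) ≤ ε / 2 := by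
    have h1 : 2 * n * L * p / ε ≤ q := (Nat.le_ceil _).trans (by exact_mod_cast hq)
    rw [div_le_iff₀ hε] at h1
    have h2 : n * (L * (p / q)) = 2 * n * L * p / q / 2 := by ring
    have : 2 * n * L * p / q ≤ ε := by rw [div_le_iff₀ hq']; linarith
    rw [h2]; linarith
  have hdkA := denjoyKoksma hp hAp (hAc.intervalIntegrable _ _) hAU
    (V := C / n * p) (fun y => by ring) hq0 hm hqa x
  rw [hAint] at hdkA
  set S : ℝ → ℝ := fun y => ∑ j ∈ Finset.range q, G (y + j * a) with hS
  have hstep : ∀ y, |S (y + a) - S y| ≤ L * (p / q) := by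
    intro y
    -- Only the end terms of the shifted sum survive, and `q * a` is within `p / q` of a multiple of
    -- the period. So the sums of `A` differ from those of `G` by at most `n * L * p / q`, which is
    -- small for large `q`.
    have : S (y + a) - S y = G (y + q * a) - G y := by
      have h1 := Finset.sum_range_succ (fun j : ℕ => G (y + j * a)) q
      have h2 := Finset.sum_range_succ' (fun j : ℕ => G (y + j * a)) q
      have h3 : S (y + a) = ∑ j ∈ Finset.range q, G (y + ((j + 1 : ℕ) : ℝ) * a) := by
        refine Finset.sum_congr rfl fun j _ => ?_
        push_cast; congr 1; ring
      rw [h3]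
      simp only [Nat.cast_zero, zero_mul, add_zero] at h2
      simp only [hS]
      linarith
    rw [this]
    have hper : G (y + q * a) = G (y + (q * a - m * p)) := by
      have := (hG.int_mul m) (y + (q * a - m * p))
      rw [← this]; congr 1; ring
    rw [hper]
    refine (hGlip _ _).trans ?_
    rw [add_sub_cancel_left]
    gcongr
  have hK0 : 0 ≤ L * (p / q) := by positivity
  have hiter : ∀ i : ℕ, |S (x + i * a) - S x| ≤ i * (L * (p / q)) := by
    intro i
    induction i with
    | zero => simp
    | succ i ih =>
      have e : x + ((i + 1 : ℕ) : ℝ) * a = x + i * a + a := by push_cast; ring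
      rw [e]
      have := hstep (x + i * a)
      push_cast
      calc |S (x + i * a + a) - S x| ≤ |S (x + i * a + a) - S (x + i * a)| + |S (x + i * a) - S x| :=
            abs_sub_le _ _ _
        _ ≤ _ := by linarith
  have hdiff : |∑ j ∈ Finset.range q, A (x + j * a) - S x| ≤ n * (L * (p / q)) := by
    have e : ∑ j ∈ Finset.range q, A (x + j * a) - S x =
        (n : ℝ)⁻¹ * ∑ i ∈ Finset.range n, (S (x + i * a) - S x) := by
      simp only [hA, Finset.sum_sub_distrib, Finset.sum_const, Finset.card_range, nsmul_eq_mul,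
        mul_sub, ← Finset.mul_sum, inv_mul_cancel_left₀ hn0.ne']
      rw [Finset.sum_comm]
      simp only [hS]
      congr 2
      refine Finset.sum_congr rfl fun i _ => Finset.sum_congr rfl fun j _ => ?_
      congr 1; ring
    rw [e, abs_mul, abs_inv, abs_of_pos hn0]
    calc (n : ℝ)⁻¹ * _ ≤ (n : ℝ)⁻¹ * ∑ i ∈ Finset.range n, n * (L * (p / q)) := by
          gcongr
          refine (Finset.abs_sum_le_sum_abs _ _).trans (Finset.sum_le_sum fun i hi => ?_)
          refine (hiter i).trans ?_
          gcongr
          exact (Finset.mem_range.1 hi).le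
      _ = _ := by
          simp only [Finset.sum_const, Finset.card_range, nsmul_eq_mul]
          field_simp
  have := abs_sub_le (S x) (∑ j ∈ Finset.range q, A (x + j * a)) (q / p * ∫ y in (0 : ℝ)..p, G y)
  rw [abs_sub_comm] at hdiff
  simp only [hS] at this hdiff
  linarith

/-! ### Extension by zero from `[0, 1)` to the longer circle -/

/-- Extension of a function on `[0, 1)` by zero to `[0, p)` and then periodically. -/
def extPeriodic {p : ℝ} (hp : 0 < p) (φ : ℝ → ℝ) (y : ℝ) : ℝ :=
  if toIcoMod hp 0 y < 1 then φ (toIcoMod hp 0 y) else 0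

theorem extPeriodic_periodic {p : ℝ} (hp : 0 < p) (φ : ℝ → ℝ) :
    Function.Periodic (extPeriodic hp φ) p := fun y => by simp [extPeriodic]

theorem toIcoMod_of_mem {p : ℝ} (hp : 0 < p) {y : ℝ} (hy : y ∈ Ico 0 p) : toIcoMod hp 0 y = y :=
  (toIcoMod_eq_self hp).2 (by simpa using hy)

theorem Ico_inter_Iio_of_lt {a b c : ℝ} (h : b < c) : Ico a c ∩ Iio b = Ico a b := by
  ext x
  simp only [mem_inter_iff, mem_Ico, mem_Iio]
  exact ⟨fun hx => ⟨hx.1.1, hx.2⟩, fun hx => ⟨⟨hx.1, hx.2.trans h⟩, hx.2⟩⟩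

theorem intervalIntegrable_extPeriodic {p : ℝ} (hp : 0 < p) {φ : ℝ → ℝ}
    (hφ : IntegrableOn φ (Ico 0 1)) : IntervalIntegrable (extPeriodic hp φ) volume 0 p := by
  rw [intervalIntegrable_iff_integrableOn_Ico_of_le hp.le]
  have h : IntegrableOn ((Ico (0 : ℝ) 1).indicator φ) (Ico 0 p) :=
    ((integrable_indicator_iff measurableSet_Ico).2 hφ).integrableOn
  refine h.congr_fun (fun y hy => ?_) measurableSet_Ico
  simp only [extPeriodic, toIcoMod_of_mem hp hy, indicator, mem_Ico, hy.1, true_and]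

theorem integral_extPeriodic {p : ℝ} (hp : 1 < p) (φ : ℝ → ℝ) :
    ∫ y in (0 : ℝ)..p, extPeriodic (zero_lt_one.trans hp) φ y = ∫ y in Ico (0 : ℝ) 1, φ y := by
  rw [intervalIntegral.integral_of_le (by linarith), ← integral_Ico_eq_integral_Ioc,
    ← Ico_inter_Iio_of_lt hp, ← setIntegral_indicator measurableSet_Iio]
  refine setIntegral_congr_fun measurableSet_Ico fun y hy => ?_
  simp only [extPeriodic, toIcoMod_of_mem (zero_lt_one.trans hp) hy, indicator, mem_Iio]

/-- The vanishing value at `0` and vanishing limit at `1` glue the function to zero at both ends of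
the gap `[1, p)`. -/
theorem continuous_extPeriodic {p : ℝ} (hp : 1 < p) {φ : ℝ → ℝ} (hφ : ContinuousOn φ (Ico 0 1))
    (h0 : φ 0 = 0) (h1 : Tendsto φ (𝓝[<] 1) (𝓝 0)) :
    Continuous (extPeriodic (zero_lt_one.trans hp) φ) := by
  have hp0 : 0 < p := zero_lt_one.trans hp
  have : Fact (0 < p) := ⟨hp0⟩
  set ψ : ℝ → ℝ := fun y => if y < 1 then φ y else 0 with hψ
  have hψc : ContinuousOn ψ (Icc 0 p) := by
    intro y hy
    rcases lt_trichotomy y 1 with h | h | h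
    · have hc : ContinuousWithinAt φ (Icc 0 p) y := by
        refine (hφ y ⟨hy.1, h⟩).mono_of_mem_nhdsWithin ?_
        filter_upwards [self_mem_nhdsWithin, mem_nhdsWithin_of_mem_nhds (Iio_mem_nhds h)]
          with z hz hz' using ⟨hz.1, hz'⟩
      refine hc.congr_of_eventuallyEq ?_ (by simp [hψ, h])
      filter_upwards [mem_nhdsWithin_of_mem_nhds (Iio_mem_nhds h)] with z hz
      simp only [hψ, if_pos (mem_Iio.1 hz)]
    · subst h
      refine ContinuousAt.continuousWithinAt ?_
      rw [continuousAt_iff_continuous_left'_right']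
      constructor
      · have : ψ 1 = 0 := by simp [hψ]
        rw [ContinuousWithinAt, this]
        refine h1.congr' ?_
        filter_upwards [self_mem_nhdsWithin] with z hz
        simp only [hψ, if_pos (mem_Iio.1 hz)]
      · refine continuousWithinAt_const.congr (f := fun _ => (0 : ℝ)) (fun z hz => ?_) (by simp [hψ])
        simp only [hψ, if_neg (not_lt.2 (le_of_lt (mem_Ioi.1 hz)))]
    · refine ContinuousAt.continuousWithinAt ?_
      refine continuousAt_const.congr (f := fun _ => (0 : ℝ)) ?_
      filter_upwards [Ioi_mem_nhds h] with z hz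
      simp only [hψ, if_neg (not_lt.2 (le_of_lt (mem_Ioi.1 hz)))]
  have hc := AddCircle.liftIco_zero_continuous (p := p) (f := ψ)
    (by simp [hψ, h0, not_lt.2 hp.le]) hψc
  exact hc.comp (AddCircle.continuous_mk' p)

/-- Corners can occur only at the ends of the gap. The right derivative exists even there, since
`[0, 1)` and `[1, p)` are closed on the left. -/
theorem hasDerivWithinAt_extPeriodic {p : ℝ} (hp : 1 < p) {φ φ' : ℝ → ℝ}
    (hφ : ∀ y ∈ Ico (0 : ℝ) 1, HasDerivWithinAt φ (φ' y) (Ico 0 1) y) (y : ℝ) :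
    HasDerivWithinAt (extPeriodic (zero_lt_one.trans hp) φ)
      (extPeriodic (zero_lt_one.trans hp) φ' y) (Ici y) y := by
  have hp0 : 0 < p := zero_lt_one.trans hp
  have key : ∀ z ∈ Ico 0 p, HasDerivWithinAt (extPeriodic hp0 φ) (extPeriodic hp0 φ' z) (Ici z) z := by
    intro z hz
    by_cases h : z < 1
    · have e : extPeriodic hp0 φ' z = φ' z := by simp [extPeriodic, toIcoMod_of_mem hp0 hz, h]
      rw [e]
      have hd : HasDerivWithinAt φ (φ' z) (Ici z) z := by
        refine (hφ z ⟨hz.1, h⟩).mono_of_mem_nhdsWithin ?_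
        filter_upwards [self_mem_nhdsWithin, mem_nhdsWithin_of_mem_nhds (Iio_mem_nhds h)]
          with w hw hw' using ⟨hz.1.trans hw, hw'⟩
      refine hd.congr_of_eventuallyEq ?_ (by simp [extPeriodic, toIcoMod_of_mem hp0 hz, h])
      filter_upwards [self_mem_nhdsWithin, mem_nhdsWithin_of_mem_nhds (Iio_mem_nhds h)] with w hw hw'
      have hw0 : w ∈ Ico 0 p := ⟨hz.1.trans hw, (mem_Iio.1 hw').trans hp⟩
      simp [extPeriodic, toIcoMod_of_mem hp0 hw0, mem_Iio.1 hw']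
    · have e : extPeriodic hp0 φ' z = 0 := by simp [extPeriodic, toIcoMod_of_mem hp0 hz, h]
      rw [e]
      refine (hasDerivWithinAt_const z (Ici z) (0 : ℝ)).congr_of_eventuallyEq ?_
        (by simp [extPeriodic, toIcoMod_of_mem hp0 hz, h])
      filter_upwards [self_mem_nhdsWithin, mem_nhdsWithin_of_mem_nhds (Iio_mem_nhds hz.2)] with w hw hw'
      have hw0 : w ∈ Ico 0 p := ⟨hz.1.trans hw, hw'⟩
      have hw1 : ¬ w < 1 := fun hc => h (lt_of_le_of_lt hw hc)
      simp [extPeriodic, toIcoMod_of_mem hp0 hw0, hw1]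
  set k := toIcoDiv hp0 0 y
  have hz : y - k * p ∈ Ico 0 p := by
    have := sub_toIcoDiv_zsmul_mem_Ico hp0 0 y
    rwa [zsmul_eq_mul, zero_add] at this
  have hd := key _ hz
  rw [(extPeriodic_periodic hp0 φ').sub_int_mul_eq] at hd
  have h1 : HasDerivWithinAt (fun x : ℝ => x - k * p) 1 (Ici y) y :=
    ((hasDerivAt_id y).sub_const _).hasDerivWithinAt
  have h2 := hd.comp y h1 (fun w hw => by simp only [mem_Ici] at hw ⊢; linarith)
  simpa [Function.comp_def, (extPeriodic_periodic hp0 φ).sub_int_mul_eq] using h2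

/-- Denjoy–Koksma inequality for the extension of a function of bounded variation on `[0, 1)`. -/
theorem denjoyKoksma_extPeriodic {p a : ℝ} (hp : 1 < p) {φ : ℝ → ℝ}
    (hφ : BoundedVariationOn φ (Ico 0 1)) (hi : IntegrableOn φ (Ico 0 1)) {C : ℝ}
    (hC : ∀ y ∈ Ico (0 : ℝ) 1, |φ y| ≤ C) {q : ℕ} (hq : GoodDenominator p a q) (x : ℝ) :
    |∑ j ∈ Finset.range q, extPeriodic (zero_lt_one.trans hp) φ (x + j * a) -
      q / p * ∫ y in Ico (0 : ℝ) 1, φ y| ≤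
        2 * ((eVariationOn φ (Ico 0 1)).toReal + C + 2 * C) := by
  have hp0 : 0 < p := zero_lt_one.trans hp
  have hC0 : 0 ≤ C := (abs_nonneg _).trans (hC 0 ⟨le_rfl, one_pos⟩)
  obtain ⟨hq0, m, hm, hqa⟩ := hq
  set s : Set ℝ := Ico 0 1 with hs
  have h0s : (0 : ℝ) ∈ s := ⟨le_rfl, one_pos⟩
  have hl := hφ.locallyBoundedVariationOn
  have hle : ∀ y z, z ≤ y → variationOnFromTo φ s z y ≤ (eVariationOn φ s).toReal := by
    intro y z hzy
    rw [variationOnFromTo.eq_of_le _ _ hzy]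
    exact ENNReal.toReal_mono hφ (eVariationOn.mono _ inter_subset_left)
  rw [← integral_extPeriodic hp φ]
  refine denjoyKoksma_toIcoMod (E := fun y => if y < 1 then φ y else 0)
    -- The extra `C` on the gap bounds the jump from the values on `[0, 1)` down to `0`.
    (U := fun y => if y < 1 then variationOnFromTo φ s 0 y else (eVariationOn φ s).toReal + C)
    hp0 (intervalIntegrable_extPeriodic hp0 hi) ?_ ?_ ?_ hq0 hm hqa x
  · intro y hy
    split_ifs with h
    · exact hC y ⟨hy.1, h⟩
    · simpa using hC0
  · intro y hy
    split_ifs with h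
    · exact ⟨variationOnFromTo.nonneg_of_le _ _ hy.1, (hle _ _ hy.1).trans (by linarith)⟩
    · exact ⟨by positivity, le_rfl⟩
  · intro y hy z hz hzy
    by_cases h : y < 1
    · have hz1 : z < 1 := hzy.trans_lt h
      simp only [h, hz1, if_true]
      have hys : y ∈ s := ⟨hy.1, h⟩
      have hzs : z ∈ s := ⟨hz.1, hz1⟩
      have hadd := variationOnFromTo.add hl h0s hzs hys
      have hb : BoundedVariationOn φ (s ∩ Icc z y) := hφ.mono inter_subset_left
      have := hb.dist_le (x := y) (y := z) ⟨hys, hzy, le_rfl⟩ ⟨hzs, le_rfl, hzy⟩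
      rw [← variationOnFromTo.eq_of_le _ _ hzy, Real.dist_eq] at this
      linarith
    · by_cases h' : z < 1
      · simp only [h, h', if_true, if_false]
        rw [zero_sub, abs_neg]
        linarith [hC z ⟨hz.1, h'⟩, hle z 0 hz.1]
      · simp [h, h']

/-- Along good denominators `q`, the Birkhoff sums over `q` steps of the extension by zero of `f` are
uniformly close to `f 0 * (N - q / p)` with bounded `N - q / p`, `N` an integer. -/
theorem exists_int_birkhoffSum_extPeriodic {f : ℝ → ℝ} (hf : IsC1AC f)
    (hint : ∫ x in Ico (0 : ℝ) 1, f x = 0) (hlim : Tendsto f (𝓝[<] (1 : ℝ)) (𝓝 (f 0)))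
    {p a : ℝ} (hp : 1 < p) (hinf : ∀ N, ∃ n ≥ N, GoodDenominator p a n) {ε : ℝ} (hε : 0 < ε) :
    ∃ Q, ∀ q ≥ Q, GoodDenominator p a q → ∀ x, ∃ N : ℤ, |N - q / p| ≤ 6 ∧
      |∑ j ∈ Finset.range q, extPeriodic (zero_lt_one.trans hp) f (x + j * a) - f 0 * (N - q / p)| ≤
        ε := by
  have hp0 : 0 < p := zero_lt_one.trans hp
  obtain ⟨g, hfg, hac, hbv⟩ := hf
  have h0s : (0 : ℝ) ∈ Ico (0 : ℝ) 1 := ⟨le_rfl, one_pos⟩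
  have hgc : ContinuousOn g (Ico 0 1) := by
    intro y hy
    obtain ⟨b, hyb, hb⟩ := exists_between hy.2
    have hb0 : 0 ≤ b := hy.1.trans hyb.le
    have h1 := (hac b ⟨hb0, hb⟩).continuousOn
    rw [uIcc_of_le hb0] at h1
    refine (h1 y ⟨hy.1, hyb.le⟩).mono_of_mem_nhdsWithin ?_
    filter_upwards [self_mem_nhdsWithin, mem_nhdsWithin_of_mem_nhds (Iio_mem_nhds hyb)]
      with z hz hz' using ⟨hz.1, le_of_lt hz'⟩
  set C : ℝ := |g 0| + (eVariationOn g (Ico 0 1)).toReal with hCdef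
  have hC : ∀ y ∈ Ico (0 : ℝ) 1, |g y| ≤ C := by
    intro y hy
    have h1 := hbv.dist_le hy h0s
    rw [Real.dist_eq] at h1
    have h2 := abs_sub_abs_le_abs_sub (g y) (g 0)
    rw [hCdef]; linarith
  have hC0 : 0 ≤ C := (abs_nonneg _).trans (hC 0 h0s)
  have hgi : IntegrableOn g (Ico 0 1) :=
    IntegrableOn.of_bound (by simp) (hgc.aestronglyMeasurable measurableSet_Ico) C
      ((ae_restrict_iff' measurableSet_Ico).2 (ae_of_all _ fun y hy => hC y hy))
  set φ : ℝ → ℝ := fun y => f y - f 0 with hφ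
  have hφd : ∀ y ∈ Ico (0 : ℝ) 1, HasDerivWithinAt φ (g y) (Ico 0 1) y :=
    fun y hy => (hfg y hy).sub_const _
  have hGc : Continuous (extPeriodic hp0 φ) := by
    refine continuous_extPeriodic hp (fun y hy => (hφd y hy).continuousWithinAt) (by simp [hφ]) ?_
    simpa [hφ] using hlim.sub_const (f 0)
  have hGd := hasDerivWithinAt_extPeriodic hp hφd
  -- The integral of the derivative is the increment of a continuous periodic function over one
  -- period. This is where equality of the two end values of `f` is used, through `hGc`.
  have hmean : ∫ y in Ico (0 : ℝ) 1, g y = 0 := by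
    rw [← integral_extPeriodic hp g, intervalIntegral.integral_eq_sub_of_hasDeriv_right
      hGc.continuousOn (fun x _ => (hGd x).mono Ioi_subset_Ici_self)
      (intervalIntegrable_extPeriodic hp0 hgi)]
    have := extPeriodic_periodic hp0 φ 0
    rw [zero_add] at this
    linarith
  have hφi : IntegrableOn φ (Ico 0 1) := by
    have h1 : IntegrableOn (extPeriodic hp0 φ) (Ico 0 1) :=
      (hGc.continuousOn.integrableOn_Icc (a := 0) (b := 1)).mono_set Ico_subset_Icc_self
    refine h1.congr_fun (fun y hy => ?_) measurableSet_Ico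
    simp [extPeriodic, toIcoMod_of_mem hp0 (⟨hy.1, hy.2.trans hp⟩ : y ∈ Ico 0 p), hy.2]
  have hfi : IntegrableOn f (Ico 0 1) := by
    have : f = fun y => φ y + f 0 := by simp [hφ]
    rw [this]
    exact hφi.add (integrableOn_const (by simp) (by simp))
  have hφint : ∫ y in Ico (0 : ℝ) 1, φ y = - f 0 := by
    simp only [hφ]
    rw [integral_sub hfi (integrableOn_const (by simp) (by simp)), hint]
    simp
  have hGb : ∀ y, |extPeriodic hp0 g y| ≤ C := by
    intro y
    have hm := toIcoMod_mem_Ico hp0 0 y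
    unfold extPeriodic
    split_ifs with h
    · exact hC _ ⟨hm.1, h⟩
    · simpa using hC0
  obtain ⟨Q, hQ⟩ := birkhoffSum_smooth_tendsto hp0 (extPeriodic_periodic hp0 φ) hGc hGd hGb
    (C := 2 * ((eVariationOn g (Ico 0 1)).toReal + C + 2 * C)) (fun n hn x => by
      have := denjoyKoksma_extPeriodic hp hbv hgi hC hn x
      rwa [hmean, mul_zero, sub_zero] at this) hinf hε
  refine ⟨Q, fun q hq hgood x => ?_⟩
  have h1 := hQ q hq hgood x
  rw [integral_extPeriodic hp φ, hφint] at h1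
  -- For the constant `1` the variation is `0` and the bound is `1`, so Denjoy–Koksma gives `2 * (0
  -- + 1 + 2) = 6`.
  set χ : ℝ → ℝ := fun _ => 1 with hχ
  have hχv : eVariationOn χ (Ico 0 1) = 0 :=
    eVariationOn.constant_on (by rintro _ ⟨_, _, rfl⟩ _ ⟨_, _, rfl⟩; rfl)
  have h2 := denjoyKoksma_extPeriodic (φ := χ) (C := 1) hp
    (by rw [BoundedVariationOn, hχv]; simp) (integrableOn_const (by simp) (by simp))
    (by simp [hχ]) hgood x
  rw [hχv] at h2
  have hχint : ∫ y in Ico (0 : ℝ) 1, χ y = 1 := by simp [hχ]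
  rw [hχint] at h2
  -- `N` counts the visits of the orbit to `[0, 1)`.
  refine ⟨∑ j ∈ Finset.range q, if toIcoMod hp0 0 (x + j * a) < 1 then 1 else 0, ?_, ?_⟩
  · push_cast
    have e : (q : ℝ) / p * 1 = q / p := mul_one _
    rw [e] at h2
    refine le_trans ?_ (h2.trans (by norm_num))
    simp [extPeriodic, hχ]
  · have e : ∀ y, extPeriodic hp0 f y = extPeriodic hp0 φ y +
        f 0 * (if toIcoMod hp0 0 y < 1 then 1 else 0) := by
      intro y
      unfold extPeriodic
      split_ifs <;> simp [hφ]
    simp only [e, Finset.sum_add_distrib, ← Finset.mul_sum]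
    push_cast
    convert h1 using 2
    ring

/-! ### Arithmetic of almost every pair of parameters -/

theorem goodDenominator_mul_iff {p : ℝ} (hp : 0 < p) (α : ℝ) (q : ℕ) :
    GoodDenominator p (α * p) q ↔ GoodDenominator 1 α q := by
  refine and_congr_right fun hq => exists_congr fun m => and_congr_right fun _ => ?_
  have e : q * (α * p) - m * p = (q * α - m * 1) * p := by ring
  rw [e, abs_mul, abs_of_pos hp, div_eq_mul_one_div p, mul_comm p, mul_le_mul_iff_left₀ hp]

/-- Dirichlet gives infinitely many reduced fractions; if the denominators were bounded, so would be
the numerators, leaving only finitely many fractions. -/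
theorem infinite_goodDenominator {α : ℝ} (hα : Irrational α) :
    {q | GoodDenominator 1 α q}.Infinite := by
  have hinf := Real.infinite_rat_abs_sub_lt_one_div_den_sq_of_irrational hα
  have hsub : ∀ r : ℚ, |α - r| < 1 / (r.den : ℝ) ^ 2 → |r.den * α - r.num| ≤ 1 / (r.den : ℝ) := by
    intro r hr
    have hd : (0 : ℝ) < r.den := by exact_mod_cast r.den_pos
    have e : r.den * α - r.num = r.den * (α - r) := by
      have : (r : ℝ) = r.num / r.den := Rat.cast_def r
      rw [this]; field_simp
    rw [e, abs_mul, abs_of_pos hd]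
    calc (r.den : ℝ) * |α - r| ≤ r.den * (1 / (r.den : ℝ) ^ 2) := by gcongr
      _ = _ := by field_simp
  intro hfin
  obtain ⟨N, hN⟩ := hfin.bddAbove
  refine hinf (Set.Finite.subset (((Set.finite_Icc (-⌈N * |α| + 1⌉) ⌈N * |α| + 1⌉).prod
    (Set.finite_Iic N)).image fun z : ℤ × ℕ => (z.1 : ℚ) / z.2) fun r hr => ?_)
  have h1 := hsub r hr
  have hd1 : (1 : ℝ) ≤ r.den := by exact_mod_cast r.den_pos
  have hle : r.den ≤ N := by
    refine hN ⟨r.den_pos, r.num, ?_, by simpa using h1⟩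
    exact Int.isCoprime_iff_gcd_eq_one.2 r.reduced
  have hle' : (r.den : ℝ) ≤ N := by exact_mod_cast hle
  have h2 : 1 / (r.den : ℝ) ≤ 1 := by rw [div_le_one (by linarith)]; exact hd1
  have h3 : |(r.num : ℝ)| ≤ N * |α| + 1 := by
    have h4 := abs_sub_abs_le_abs_sub (r.num : ℝ) (r.den * α)
    rw [abs_sub_comm, abs_mul, abs_of_pos (by linarith : (0 : ℝ) < r.den)] at h4
    have h5 : (r.den : ℝ) * |α| ≤ N * |α| := by gcongr
    linarith
  have h4 := h3.trans (Int.le_ceil _)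
  have h5 : |r.num| ≤ ⌈N * |α| + 1⌉ := by exact_mod_cast h4
  exact ⟨(r.num, r.den), ⟨⟨(abs_le.1 h5).1, (abs_le.1 h5).2⟩, hle⟩, Rat.num_div_den r⟩

/-- For an infinite set `Q` of integers and almost every `β`, the multiples `q * β`, `q ∈ Q`,
come arbitrarily close to `c` modulo one. -/
theorem volume_forall_le_abs_mul_sub {Q : Set ℕ} (hQ : Q.Infinite) (c : ℝ) {ε : ℝ} (hε : 0 < ε) :
    volume {β : ℝ | ∀ q ∈ Q, ∀ l : ℤ, ε ≤ |q * β - c - l|} = 0 := by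
  wlog hε1 : ε ≤ 1 / 2 generalizing ε
  · refine measure_mono_null ?_ (this (ε := 1 / 2) (by norm_num) le_rfl)
    intro β hβ q hq l
    exact (not_le.1 hε1).le.trans (hβ q hq l)
  set s := {β : ℝ | ∀ q ∈ Q, ∀ l : ℤ, ε ≤ |q * β - c - l|} with hs
  by_contra hne
  have hd := Besicovitch.ae_tendsto_measure_inter_div (volume : Measure ℝ) s
  have hne' : (ae (volume.restrict s)).NeBot := by
    rw [ae_neBot]; intro h; exact hne (Measure.restrict_eq_zero.1 h)
  obtain ⟨β, hβ⟩ := hd.exists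
  have hlt : ENNReal.ofReal (1 - ε) < 1 := by
    rw [ENNReal.ofReal_lt_one]; linarith
  have hev := hβ.eventually (lt_mem_nhds hlt)
  rw [eventually_nhdsWithin_iff, Metric.eventually_nhds_iff] at hev
  obtain ⟨δ, hδ, hev⟩ := hev
  obtain ⟨q, hq, hqN⟩ := hQ.exists_gt ⌈1 / δ⌉₊
  have hq0 : (0 : ℝ) < q := by exact_mod_cast (Nat.zero_le _).trans_lt hqN
  have hqδ : 1 / (q : ℝ) < δ := by
    have : 1 / δ < q := (Nat.le_ceil _).trans_lt (by exact_mod_cast hqN)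
    rw [div_lt_iff₀ hδ] at this
    rw [div_lt_iff₀ hq0]; linarith
  have hr0 : 0 < 1 / (q : ℝ) := by positivity
  have h1 := hev (y := 1 / (q : ℝ)) (by rwa [Real.dist_eq, sub_zero, abs_of_pos hr0]) hr0
  set l := round (q * β - c)
  set z := (c + l) / q with hz
  have hl : |q * β - c - l| ≤ 1 / 2 := abs_sub_round _
  have hzβ : |z - β| ≤ 1 / 2 * (1 / q) := by
    have e : z - β = -(q * β - c - l) * (1 / q) := by rw [hz]; field_simp; ring
    rw [e, abs_mul, abs_neg, abs_of_pos hr0]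
    gcongr
  have hball : Metric.ball z (ε * (1 / q)) ⊆ Metric.closedBall β (1 / q) := by
    intro w hw
    rw [Metric.mem_ball, Real.dist_eq] at hw
    rw [Metric.mem_closedBall, Real.dist_eq]
    have := abs_sub_le w z β
    have h2 : ε * (1 / q) ≤ 1 / 2 * (1 / (q : ℝ)) := by gcongr
    linarith
  have hdisj : s ∩ Metric.closedBall β (1 / q) ⊆
      Metric.closedBall β (1 / q) \ Metric.ball z (ε * (1 / q)) := by
    rintro w ⟨hws, hwb⟩
    refine ⟨hwb, fun hw => ?_⟩
    rw [Metric.mem_ball, Real.dist_eq] at hw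
    have h2 := hws q hq l
    have e : q * w - c - l = q * (w - z) := by rw [hz]; field_simp; ring
    rw [e, abs_mul, abs_of_pos hq0] at h2
    have h3 : (q : ℝ) * |w - z| < q * (ε * (1 / q)) := by gcongr
    have h4 : (q : ℝ) * (ε * (1 / q)) = ε := by field_simp
    linarith
  have hmeas : volume (s ∩ Metric.closedBall β (1 / (q : ℝ))) ≤
      ENNReal.ofReal (2 * (1 / q) - 2 * (ε * (1 / q))) := by
    refine (measure_mono hdisj).trans ?_
    rw [measure_sdiff hball measurableSet_ball.nullMeasurableSet (by rw [Real.volume_ball]; exact ENNReal.ofReal_ne_top),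
      Real.volume_closedBall, Real.volume_ball, ENNReal.ofReal_sub _ (by positivity)]
  rw [Real.volume_closedBall] at h1
  have h2 : volume (s ∩ Metric.closedBall β (1 / (q : ℝ))) / ENNReal.ofReal (2 * (1 / q)) ≤
      ENNReal.ofReal (1 - ε) := by
    rw [ENNReal.div_le_iff (by simp [hq0]) ENNReal.ofReal_ne_top, ← ENNReal.ofReal_mul (by linarith)]
    refine hmeas.trans (le_of_eq ?_)
    congr 1; ring
  exact absurd h1 (not_lt.2 h2)

/-- The arithmetic condition on the rotation number `α` and the discontinuity `β`: along good
denominators `q` of `α` the numbers `q * β` are dense modulo one. -/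
def GoodPair (z : ℝ × ℝ) : Prop :=
  Irrational z.1 ∧ ∀ (c : ℚ) (n : ℕ), ∃ q : ℕ, n < q ∧ GoodDenominator 1 z.1 q ∧
    ∃ l : ℤ, |q * z.2 - c - l| < 1 / (n + 1)

/-- Rational targets and tolerances `1 / (n + 1)` leave countably many conditions, each of which
fails only on a null set. -/
theorem ae_goodPair_of_irrational {α : ℝ} (hα : Irrational α) : ∀ᵐ β : ℝ, GoodPair (α, β) := by
  have : ∀ᵐ β : ℝ, ∀ (c : ℚ) (n : ℕ), ∃ q : ℕ, n < q ∧ GoodDenominator 1 α q ∧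
      ∃ l : ℤ, |q * β - c - l| < 1 / (n + 1) := by
    refine ae_all_iff.2 fun c => ae_all_iff.2 fun n => ?_
    have h := volume_forall_le_abs_mul_sub (Q := {q | GoodDenominator 1 α q} \ Iic n)
      ((infinite_goodDenominator hα).sdiff (finite_Iic n)) c (ε := 1 / (n + 1)) (by positivity)
    rw [ae_iff]
    refine measure_mono_null ?_ h
    intro β hβ q hq l
    by_contra hlt
    exact hβ ⟨q, not_le.1 hq.2, hq.1, l, not_le.1 hlt⟩
  filter_upwards [this] with β hβ using ⟨hα, hβ⟩

theorem measurableSet_goodPair : MeasurableSet {z | GoodPair z} := by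
  have hirr : MeasurableSet {z : ℝ × ℝ | Irrational z.1} :=
    measurable_fst (countable_range ((↑) : ℚ → ℝ)).measurableSet.compl
  have hgood : ∀ q : ℕ, MeasurableSet {z : ℝ × ℝ | GoodDenominator 1 z.1 q} := by
    intro q
    have h : MeasurableSet {z : ℝ × ℝ | ∃ m : ℤ, IsCoprime m (q : ℤ) ∧
        |q * z.1 - m * 1| ≤ 1 / q} := by
      rw [ofPred_exists]
      refine MeasurableSet.iUnion fun m => MeasurableSet.inter (MeasurableSet.const _) ?_
      exact measurableSet_le (f := fun z : ℝ × ℝ => |q * z.1 - m * 1|) (by fun_prop) measurable_const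
    exact MeasurableSet.inter (MeasurableSet.const _) h
  have hdense : MeasurableSet {z : ℝ × ℝ | ∀ (c : ℚ) (n : ℕ), ∃ q : ℕ, n < q ∧
      GoodDenominator 1 z.1 q ∧ ∃ l : ℤ, |q * z.2 - c - l| < 1 / (n + 1)} := by
    rw [ofPred_forall]
    refine MeasurableSet.iInter fun c => ?_
    rw [ofPred_forall]
    refine MeasurableSet.iInter fun n => ?_
    rw [ofPred_exists]
    refine MeasurableSet.iUnion fun q => ?_
    have h : MeasurableSet {z : ℝ × ℝ | ∃ l : ℤ, |q * z.2 - c - l| < 1 / (n + 1)} := by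
      rw [ofPred_exists]
      exact MeasurableSet.iUnion fun l =>
        measurableSet_lt (f := fun z : ℝ × ℝ => |q * z.2 - c - l|) (by fun_prop) measurable_const
    exact MeasurableSet.inter (MeasurableSet.const _) ((hgood q).inter h)
  exact hirr.inter hdense

theorem ae_goodPair : ∀ᵐ z : ℝ × ℝ, GoodPair z := by
  rw [ae_iff]
  have hm : MeasurableSet {z | ¬ GoodPair z} := measurableSet_goodPair.compl
  rw [Measure.volume_eq_prod, Measure.measure_prod_null hm]
  have hirr : ∀ᵐ α : ℝ, Irrational α := (countable_range ((↑) : ℚ → ℝ)).ae_notMem volume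
  filter_upwards [hirr] with α hα using ae_iff.1 (ae_goodPair_of_irrational hα)

open LengthSimplex in
theorem ae_goodPair_lebSimplex :
    ∀ᵐ l ∂lebSimplex, GoodPair ((lB l + lC l) / (1 + lB l), 1 / (1 + lB l)) := by
  -- `Φ` recovers `(lA, lB)` from the arithmetic parameters: `lB = 1 / β - 1` and `1 - lA = α / β`.
  -- It is differentiable off `β = 0`, so it sends null sets to null sets.
  set Φ : ℝ × ℝ → ℝ × ℝ := fun z => (1 - z.1 / z.2, 1 / z.2 - 1) with hΦ
  set s : Set (ℝ × ℝ) := {z | ¬ GoodPair z ∧ z.2 ≠ 0}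
  have hs : volume s = 0 := measure_mono_null (fun z hz => hz.1) (ae_iff.1 ae_goodPair)
  have himg : volume (Φ '' s) = 0 := by
    refine addHaar_image_eq_zero_of_differentiableOn_of_addHaar_eq_zero volume ?_ hs
    intro z hz
    have hz2 : z.2 ≠ 0 := hz.2
    have : DifferentiableAt ℝ Φ z := by
      refine DifferentiableAt.prodMk ?_ ?_ <;> fun_prop (disch := assumption)
    exact this.differentiableWithinAt
  have hopen : MeasurableSet LengthSimplex := by
    refine (measurableSet_lt measurable_const measurable_fst).inter
      ((measurableSet_lt measurable_const measurable_snd).inter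
        (measurableSet_lt (measurable_fst.add measurable_snd) measurable_const))
  rw [ae_iff, lebSimplex, (MeasurableEmbedding.subtype_coe hopen).comap_apply]
  refine measure_mono_null ?_ himg
  rintro _ ⟨l, hl, rfl⟩
  have hB := lB_pos l
  refine ⟨_, ⟨hl, by positivity⟩, ?_⟩
  have h2 : 1 + l.1.2 ≠ 0 := by
    have : 0 < l.1.2 := hB
    positivity
  ext
  · simp only [hΦ, lB, lC]; field_simp; ring
  · simp only [hΦ, lB]; field_simp; ring

/-! ### Essential values and the ergodicity criterion -/

/-- Translates of a bounded measurable function on the circle depend continuously in measure on the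
translation. -/
theorem tendsto_measure_le_abs_translate_sub {p : ℝ} [Fact (0 < p)] {φ : AddCircle p → ℝ}
    (hφ : Measurable φ) {M : ℝ} (hM : ∀ x, |φ x| ≤ M) {η : ℝ} (hη : 0 < η) :
    Tendsto (fun y => volume {x | η ≤ |φ (x + y) - φ x|}) (𝓝 0) (𝓝 0) := by
  have hmem : MemLp φ 1 (volume : Measure (AddCircle p)) :=
    MemLp.of_bound hφ.aestronglyMeasurable M (ae_of_all _ hM)
  let g : C(AddCircle p, C(AddCircle p, AddCircle p)) :=
    (ContinuousMap.mk (fun z : AddCircle p × AddCircle p => z.2 + z.1) (by fun_prop)).curry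
  have hg : ∀ y, MeasurePreserving (g y) (volume : Measure (AddCircle p)) volume :=
    fun y => measurePreserving_add_right volume y
  have hcont : Continuous fun y =>
      Lp.compMeasurePreserving (g y) (hg y) (hmem.toLp φ) :=
    continuous_const.compMeasurePreservingLp g.continuous hg (by simp)
  have ht := hcont.tendsto 0
  have h0 : Lp.compMeasurePreserving (g 0) (hg 0) (hmem.toLp φ) =ᵐ[volume] φ := by
    refine (Lp.coeFn_compMeasurePreserving _ (hg 0)).trans ?_
    have : φ = φ ∘ g 0 := by ext x; simp [g]
    nth_rewrite 2 [this]
    exact (hg 0).quasiMeasurePreserving.ae_eq_comp hmem.coeFn_toLp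
  have hy : ∀ y, Lp.compMeasurePreserving (g y) (hg y) (hmem.toLp φ) =ᵐ[volume]
      fun x => φ (x + y) := fun y =>
    (Lp.coeFn_compMeasurePreserving _ (hg y)).trans
      ((hg y).quasiMeasurePreserving.ae_eq_comp hmem.coeFn_toLp)
  have hT := tendstoInMeasure_iff_norm.1 ((tendstoInMeasure_of_tendsto_Lp ht).congr hy h0) η hη
  simpa [Real.norm_eq_abs] using hT

/-- Setting for essential values: a family `x ↦ H x` of Lipschitz functions on the line which is
invariant under a skew product over a rotation. -/
structure SkewInvariant {p : ℝ} (a : AddCircle p) (F : AddCircle p → ℝ)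
    (H : AddCircle p → ℝ → ℝ) : Prop where
  measurable : ∀ t, Measurable fun x => H x t
  bounded : ∃ M, ∀ x t, |H x t| ≤ M
  lipschitz : ∀ x s t, |H x s - H x t| ≤ |s - t|
  invariant : ∀ x t, H (x + a) (t + F x) = H x t

/-- The common periods of almost all functions of the family. -/
def aePeriods {p : ℝ} [Fact (0 < p)] (H : AddCircle p → ℝ → ℝ) : AddSubgroup ℝ where
  carrier := {v | ∀ᵐ x, ∀ t, H x (t + v) = H x t}
  zero_mem' := by simp
  add_mem' := by
    intro v w hv hw
    rw [mem_ofPred_eq] at hv hw ⊢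
    filter_upwards [hv, hw] with x hx hx' t
    rw [← add_assoc, hx', hx]
  neg_mem' := by
    intro v hv
    rw [mem_ofPred_eq] at hv ⊢
    filter_upwards [hv] with x hx t
    rw [← hx (t + -v), neg_add_cancel_right]

/-- If for every `c` some `d * (k - c)`, `k` an integer, is a period, then periods are dense. -/
theorem dense_aePeriods {p : ℝ} [Fact (0 < p)] {H : AddCircle p → ℝ → ℝ} {d : ℝ} (hd : d ≠ 0)
    (hc : ∀ c : ℝ, ∃ k : ℤ, d * (k - c) ∈ aePeriods H) : Dense (aePeriods H : Set ℝ) := by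
  rcases (aePeriods H).dense_or_cyclic with hde | ⟨b, hb⟩
  · exact hde
  exfalso
  refine not_countable_univ (α := ℝ) (Set.Countable.mono ?_
    (countable_range fun z : ℤ × ℤ => (z.1 : ℝ) - z.2 * b / d))
  intro c _
  obtain ⟨k, hk⟩ := hc c
  rw [hb, AddSubgroup.mem_closure_singleton] at hk
  obtain ⟨n, hn⟩ := hk
  rw [zsmul_eq_mul] at hn
  refine ⟨(k, n), ?_⟩
  simp only [hn]
  field_simp
  ring

namespace SkewInvariant

variable {p : ℝ} {a : AddCircle p} {F : AddCircle p → ℝ} {H : AddCircle p → ℝ → ℝ}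

theorem continuous (h : SkewInvariant a F H) (x : AddCircle p) : Continuous (H x) :=
  (LipschitzWith.of_dist_le_mul (K := 1) fun s t => by
    simpa [Real.dist_eq] using h.lipschitz x s t).continuous

theorem iterate (h : SkewInvariant a F H) (n : ℕ) (x : AddCircle p) (t : ℝ) :
    H (x + n • a) (t + ∑ j ∈ Finset.range n, F (x + j • a)) = H x t := by
  induction n with
  | zero => simp
  | succ n ih =>
    rw [← ih, Finset.sum_range_succ, succ_nsmul, ← add_assoc, ← add_assoc, h.invariant]

variable [Fact (0 < p)]

/-- The set of `x` for which `v` is a period of `H x` is rotation invariant, hence null or conull.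
When the sum over `n` steps is near `v`, invariance and the Lipschitz bound make `H (x + n • a)`
shifted by `v` close to `H x`. As `n • a` is small, `H (x + n • a)` is close to `H x` in measure, so
approximate periodicity holds on a set of measure bounded below, which excludes the null case. -/
theorem mem_periods_of_frequently (h : SkewInvariant a F H) (ha : addOrderOf a = 0) {v : ℝ}
    {δ : ENNReal} (hδ : δ ≠ 0)
    (hv : ∀ ε > 0, ∃ n : ℕ, ‖n • a‖ < ε ∧
      δ ≤ volume {x | |∑ j ∈ Finset.range n, F (x + j • a) - v| < ε}) :
    v ∈ aePeriods H := by
  set Z : Set (AddCircle p) := {x | ∀ t, H x (t + v) = H x t} with hZ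
  -- Approximate periodicity tested at finitely many points of a dense sequence: these sets decrease
  -- to `Z`, so their measures tend to `0` if `Z` is null.
  set E : ℕ → Set (AddCircle p) := fun m =>
    ⋂ i ∈ Iic m, {x | |H x (denseSeq ℝ i + v) - H x (denseSeq ℝ i)| ≤ 1 / (m + 1)} with hE
  have hEm : ∀ m, MeasurableSet (E m) := fun m =>
    MeasurableSet.biInter (to_countable _) fun i _ =>
      measurableSet_le (by have := h.measurable; fun_prop) measurable_const
  have hEanti : Antitone E := by
    intro m n hmn x hx
    simp only [hE, mem_iInter, mem_Iic] at hx ⊢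
    intro i hi
    refine le_trans (mem_ofPred_eq.mp (hx i (hi.trans hmn))) ?_
    gcongr
  have hZE : Z = ⋂ m, E m := by
    ext x
    simp only [hZ, hE, mem_iInter, mem_Iic, mem_ofPred_eq]
    constructor
    · intro hx m i _
      rw [hx, sub_self, abs_zero]; positivity
    · intro hx
      have hc := h.continuous x
      have : (fun t => H x (t + v)) = H x := by
        refine (denseRange_denseSeq ℝ).equalizer (by fun_prop) hc ?_
        funext i
        refine eq_of_abs_sub_nonpos (ge_of_tendsto
          (tendsto_one_div_add_atTop_nhds_zero_nat (𝕜 := ℝ)) ?_)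
        filter_upwards [eventually_ge_atTop i] with m hm using hx m i hm
      exact congrFun this
  have hZm : MeasurableSet Z := hZE ▸ MeasurableSet.iInter hEm
  have hZinv : (fun x => a + x) ⁻¹' Z = Z := by
    ext x
    simp only [hZ, mem_preimage, mem_ofPred_eq, add_comm a]
    constructor
    · intro hx t
      rw [← h.invariant x t, ← h.invariant x (t + v), add_right_comm, hx]
    · intro hx t
      have e1 := h.invariant x (t - F x)
      have e2 := h.invariant x (t - F x + v)
      rw [sub_add_cancel] at e1
      rw [show t - F x + v + F x = t + v by ring] at e2
      rw [e1, e2, hx]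
  have herg : Ergodic (fun x => a + x) (volume : Measure (AddCircle p)) :=
    AddCircle.ergodic_add_left.2 ha
  rcases herg.toPreErgodic.measure_self_or_compl_eq_zero hZm hZinv with h0 | h0
  swap
  · exact h0
  exfalso
  have hlimE : Tendsto (fun m => volume (E m)) atTop (𝓝 0) := by
    have := tendsto_measure_iInter_atTop (μ := volume) (fun m => (hEm m).nullMeasurableSet) hEanti
      ⟨0, measure_ne_top _ _⟩
    rwa [← hZE, h0] at this
  have hδ2 : 0 < δ / 2 := ENNReal.half_pos hδ
  obtain ⟨m, hm⟩ := (hlimE.eventually (gt_mem_nhds hδ2)).exists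
  obtain ⟨M, hM⟩ := h.bounded
  set η : ℝ := 1 / (m + 1) with hη
  have hη0 : 0 < η := by positivity
  set Y : ℕ → AddCircle p → Set (AddCircle p) := fun i y =>
    {x | η / 2 ≤ |H (x + y) (denseSeq ℝ i + v) - H x (denseSeq ℝ i + v)|} with hY
  have hYlim : Tendsto (fun y => ∑ i ∈ Finset.range (m + 1), volume (Y i y)) (𝓝 0) (𝓝 0) := by
    have := tendsto_finsetSum (Finset.range (m + 1)) fun i _ =>
      tendsto_measure_le_abs_translate_sub (h.measurable (denseSeq ℝ i + v)) (fun x => hM x _)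
        (half_pos hη0)
    simpa using this
  have hev := hYlim.eventually (gt_mem_nhds hδ2)
  rw [Metric.eventually_nhds_iff] at hev
  obtain ⟨ε, hε, hev⟩ := hev
  obtain ⟨n, hn, hB⟩ := hv (min ε (η / 2)) (lt_min hε (by positivity))
  have hYn := hev (y := n • a) (by rw [dist_zero_right]; exact hn.trans_le (min_le_left _ _))
  have hsub : {x | |∑ j ∈ Finset.range n, F (x + j • a) - v| < min ε (η / 2)} ⊆
      E m ∪ ⋃ i ∈ Finset.range (m + 1), Y i (n • a) := by
    intro x hx
    by_contra hcon
    simp only [mem_union, not_or, mem_iUnion, not_exists, hE, mem_iInter, not_forall, mem_Iic, hY,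
      mem_ofPred_eq, not_le, Finset.mem_range] at hcon
    -- Outside `E m` some test point shows a defect above `η`; the error in the sum accounts for
    -- less than `η / 2`, and so would the translation outside every `Y i`, a contradiction.
    obtain ⟨⟨i, hi, h1⟩, h2⟩ := hcon
    have h2 := h2 i (by omega)
    have h3 := h.iterate n x (denseSeq ℝ i)
    have h4 := h.lipschitz (x + n • a) (denseSeq ℝ i + v)
      (denseSeq ℝ i + ∑ j ∈ Finset.range n, F (x + j • a))
    rw [h3, add_sub_add_left_eq_sub, abs_sub_comm v] at h4
    have h5 : |∑ j ∈ Finset.range n, F (x + j • a) - v| < η / 2 := lt_of_lt_of_le hx (min_le_right _ _)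
    have h6 := abs_sub_le (H x (denseSeq ℝ i + v)) (H (x + n • a) (denseSeq ℝ i + v))
      (H x (denseSeq ℝ i))
    rw [abs_sub_comm (H x (denseSeq ℝ i + v)) (H (x + n • a) _)] at h6
    linarith
  have := calc δ ≤ _ := hB
    _ ≤ volume (E m) + ∑ i ∈ Finset.range (m + 1), volume (Y i (n • a)) :=
      (measure_mono hsub).trans ((measure_union_le _ _).trans
        (add_le_add le_rfl (measure_biUnion_finset_le _ _)))
    _ < δ / 2 + δ / 2 := ENNReal.add_lt_add hm hYn
    _ = δ := ENNReal.add_halves δ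
  exact lt_irrefl _ this

/-- Countably many periods suffice: almost every `H x`, being continuous with a dense set of
periods, is constant, and its value is rotation invariant. -/
theorem ae_eq_const (h : SkewInvariant a F H) (ha : addOrderOf a = 0)
    (hd : Dense (aePeriods H : Set ℝ)) : ∃ c, ∀ᵐ x, ∀ t, H x t = c := by
  obtain ⟨D, hDs, hDc, hD⟩ := hd.exists_countable_dense_subset
  have hall : ∀ᵐ x, ∀ v ∈ D, ∀ t, H x (t + v) = H x t := (ae_ball_iff hDc).2 fun v hv => hDs hv
  have h0 : ∀ᵐ x, ∀ t, H x t = H x 0 := by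
    filter_upwards [hall] with x hx
    refine congrFun (Continuous.ext_on hD (h.continuous x) continuous_const fun v hv => ?_)
    simpa using hx v hv 0
  have herg : Ergodic (fun x => a + x) (volume : Measure (AddCircle p)) :=
    AddCircle.ergodic_add_left.2 ha
  obtain ⟨c, hc⟩ := herg.ae_eq_const_of_ae_eq_comp_ae (g := fun x => H x 0)
    (h.measurable 0).aestronglyMeasurable (by
      filter_upwards [herg.toMeasurePreserving.quasiMeasurePreserving.ae h0] with x hx
      have := h.invariant x 0
      rw [Function.comp_apply, ← this, add_comm x, hx (0 + F x)])
  refine ⟨c, ?_⟩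
  filter_upwards [h0, hc] with x hx hx' t
  rw [hx, hx']
  rfl

end SkewInvariant

/-- The length of the part of the vertical section of `A` over `x` in the interval `[t - r, t + r]`
gives a family invariant under the skew product. -/
theorem skewInvariant_section {p : ℝ} {a : AddCircle p} {F : AddCircle p → ℝ}
    {A : Set (AddCircle p × ℝ)} (hA : MeasurableSet A)
    (hinv : ∀ x t, (x + a, t + F x) ∈ A ↔ (x, t) ∈ A) (r : ℝ) :
    SkewInvariant a F fun x t => volume.real (Prod.mk x ⁻¹' A ∩ Metric.closedBall t r) where
  measurable t := by
    have h1 : MeasurableSet (A ∩ (Prod.snd ⁻¹' Metric.closedBall t r)) :=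
      hA.inter (measurable_snd Metric.isClosed_closedBall.measurableSet)
    exact (measurable_measure_prodMk_left (ν := (volume : Measure ℝ)) h1).ennreal_toReal
  bounded := ⟨volume.real (Metric.closedBall (0 : ℝ) r), fun x t => by
    rw [abs_of_nonneg measureReal_nonneg]
    refine (measureReal_mono inter_subset_right measure_closedBall_lt_top.ne).trans (le_of_eq ?_)
    rw [Measure.real, Measure.real, Real.volume_closedBall, Real.volume_closedBall]⟩
  lipschitz x := by
    have key : ∀ s t : ℝ, volume.real (Prod.mk x ⁻¹' A ∩ Metric.closedBall s r) ≤
        volume.real (Prod.mk x ⁻¹' A ∩ Metric.closedBall t r) + |s - t| := by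
      intro s t
      have hsub : Prod.mk x ⁻¹' A ∩ Metric.closedBall s r ⊆
          (Prod.mk x ⁻¹' A ∩ Metric.closedBall t r) ∪
            -- The part of the ball at `s` outside the ball at `t` fits in an interval of length `|s
            -- - t|` on the side away from `t`.
            uIcc (if s ≤ t then s - r else t + r) (if s ≤ t then t - r else s + r) := by
        rintro y ⟨hyA, hy⟩
        by_cases hyt : y ∈ Metric.closedBall t r
        · exact Or.inl ⟨hyA, hyt⟩
        · right
          rw [Real.closedBall_eq_Icc] at hy hyt
          rw [mem_Icc, not_and_or, not_le, not_le] at hyt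
          split_ifs with hst
          · rw [uIcc_of_le (by linarith)]
            exact ⟨hy.1, hyt.elim le_of_lt fun h => by linarith [hy.2]⟩
          · rw [uIcc_of_le (by linarith)]
            exact ⟨hyt.elim (fun h => by linarith [hy.1]) le_of_lt, hy.2⟩
      have hfin : volume ((Prod.mk x ⁻¹' A ∩ Metric.closedBall t r) ∪
            uIcc (if s ≤ t then s - r else t + r) (if s ≤ t then t - r else s + r)) ≠ ⊤ :=
        ((measure_union_le _ _).trans_lt (ENNReal.add_lt_top.2
          ⟨(measure_mono inter_subset_right).trans_lt measure_closedBall_lt_top,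
            isCompact_uIcc.measure_lt_top⟩)).ne
      refine (measureReal_mono hsub hfin).trans ((measureReal_union_le _ _).trans ?_)
      gcongr
      rw [Measure.real, Real.volume_interval, ENNReal.toReal_ofReal (abs_nonneg _)]
      split_ifs
      · rw [sub_sub_sub_cancel_right, abs_sub_comm]
      · rw [add_sub_add_right_eq_sub]
    intro s t
    have h1 := key s t
    have h2 := key t s
    rw [abs_sub_comm t s] at h2
    exact abs_sub_le_iff.2 ⟨by linarith, by linarith⟩
  invariant x t := by
    have : Prod.mk x ⁻¹' A ∩ Metric.closedBall t r =
        (fun s => s + F x) ⁻¹' (Prod.mk (x + a) ⁻¹' A ∩ Metric.closedBall (t + F x) r) := by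
      ext s
      simp only [mem_inter_iff, mem_preimage, hinv, Metric.mem_closedBall, dist_add_right]
    rw [this, Measure.real, Measure.real, measure_preimage_add_right]

theorem exists_tendsto_density {B : Set ℝ} (hB : volume B ≠ 0) :
    ∃ t, Tendsto (fun m : ℕ => volume.real (B ∩ Metric.closedBall t (1 / ((m : ℝ) + 1))) /
      volume.real (Metric.closedBall (0 : ℝ) (1 / ((m : ℝ) + 1)))) atTop (𝓝 1) := by
  have hd := Besicovitch.ae_tendsto_measure_inter_div (volume : Measure ℝ) B
  have hne : (ae (volume.restrict B)).NeBot := by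
    rw [ae_neBot]; intro h; exact hB (Measure.restrict_eq_zero.1 h)
  obtain ⟨t, ht⟩ := hd.exists
  refine ⟨t, ?_⟩
  have hlim : Tendsto (fun m : ℕ => 1 / ((m : ℝ) + 1)) atTop (𝓝[>] 0) :=
    tendsto_nhdsWithin_iff.2 ⟨tendsto_one_div_add_atTop_nhds_zero_nat,
      Eventually.of_forall fun m => mem_Ioi.2 (by positivity)⟩
  have := (ENNReal.tendsto_toReal ENNReal.one_ne_top).comp (ht.comp hlim)
  simpa [Function.comp_def, Measure.real, Real.volume_closedBall] using this

/-- A criterion for ergodicity of a real skew product over an irrational rotation. -/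
theorem measure_eq_zero_or_compl_of_skewInvariant {p : ℝ} [Fact (0 < p)] {a : AddCircle p}
    (ha : addOrderOf a = 0) {F : AddCircle p → ℝ} {d : ℝ} (hd : d ≠ 0)
    (hF : ∀ c : ℝ, ∃ k : ℤ, ∃ δ : ENNReal, δ ≠ 0 ∧ ∀ ε > 0, ∃ n : ℕ, ‖n • a‖ < ε ∧
      δ ≤ volume {x | |∑ j ∈ Finset.range n, F (x + j • a) - d * (k - c)| < ε})
    {A : Set (AddCircle p × ℝ)} (hA : MeasurableSet A)
    (hinv : ∀ x t, (x + a, t + F x) ∈ A ↔ (x, t) ∈ A) : volume A = 0 ∨ volume Aᶜ = 0 := by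
  have hconst : ∀ m : ℕ, ∃ c, ∀ᵐ x : AddCircle p, ∀ t,
      volume.real (Prod.mk x ⁻¹' A ∩ Metric.closedBall t (1 / ((m : ℝ) + 1))) = c := by
    intro m
    have h := skewInvariant_section hA hinv (1 / ((m : ℝ) + 1))
    refine h.ae_eq_const ha (dense_aePeriods hd fun c => ?_)
    obtain ⟨k, δ, hδ, hk⟩ := hF c
    exact ⟨k, h.mem_periods_of_frequently ha hδ hk⟩
  choose c hc using hconst
  have hc := ae_all_iff.2 hc
  by_contra hcon
  rw [not_or] at hcon
  have exists_point : ∀ B : Set (AddCircle p × ℝ), MeasurableSet B → volume B ≠ 0 →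
      ∃ x, (∀ (m : ℕ) t,
        volume.real (Prod.mk x ⁻¹' A ∩ Metric.closedBall t (1 / ((m : ℝ) + 1))) = c m) ∧
        volume (Prod.mk x ⁻¹' B) ≠ 0 := by
    intro B hB hB0
    rw [Measure.volume_eq_prod, Ne, Measure.measure_prod_null hB] at hB0
    obtain ⟨x, hx, hx'⟩ := ((not_eventually.1 hB0).and_eventually hc).exists
    exact ⟨x, hx', hx⟩
  -- If neither `A` nor its complement were null, a density point of a section of each would give
  -- two densities tending to `1`. The section measures of `A` are the same constants over both base
  -- points, so the two densities sum to `1` at every radius.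
  obtain ⟨x, hx, hxA⟩ := exists_point A hA hcon.1
  obtain ⟨y, hy, hyA⟩ := exists_point Aᶜ hA.compl hcon.2
  obtain ⟨t, ht⟩ := exists_tendsto_density hxA
  obtain ⟨s, hs⟩ := exists_tendsto_density hyA
  simp only [hx] at ht
  have hsum := ht.add hs
  have hone : ∀ m : ℕ, c m / volume.real (Metric.closedBall (0 : ℝ) (1 / ((m : ℝ) + 1))) +
      volume.real (Prod.mk y ⁻¹' Aᶜ ∩ Metric.closedBall s (1 / ((m : ℝ) + 1))) /
        volume.real (Metric.closedBall (0 : ℝ) (1 / ((m : ℝ) + 1))) = 1 := by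
    intro m
    have hr : (0 : ℝ) < 1 / ((m : ℝ) + 1) := by positivity
    have e : volume.real (Metric.closedBall (0 : ℝ) (1 / ((m : ℝ) + 1))) =
        volume.real (Metric.closedBall s (1 / ((m : ℝ) + 1))) := by
      rw [Measure.real, Measure.real, Real.volume_closedBall, Real.volume_closedBall]
    have hpos : 0 < volume.real (Metric.closedBall s (1 / ((m : ℝ) + 1))) := by
      rw [Measure.real, Real.volume_closedBall, ENNReal.toReal_ofReal (by positivity)]
      positivity
    have hsplit := measureReal_inter_add_sdiff (μ := volume)
      (s := Metric.closedBall s (1 / ((m : ℝ) + 1)))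
      (measurable_prodMk_left hA : MeasurableSet (Prod.mk y ⁻¹' A)) measure_closedBall_lt_top.ne
    rw [inter_comm, hy, sdiff_eq, inter_comm, ← preimage_compl] at hsplit
    rw [e, ← add_div, hsplit, div_self hpos.ne']
  simp only [hone] at hsum
  have := tendsto_nhds_unique hsum tendsto_const_nhds
  norm_num at this

/-! ### Ergodicity over the rotation -/

theorem GoodPair.exists_denominator {α β : ℝ} (h : GoodPair (α, β)) (c : ℝ) {ε : ℝ} (hε : 0 < ε)
    (N : ℕ) : ∃ q ≥ N, GoodDenominator 1 α q ∧ ∃ l : ℤ, |q * β - c - l| < ε := by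
  obtain ⟨c', hc', hc''⟩ := exists_rat_btwn (show c < c + ε / 2 by linarith)
  obtain ⟨n, hn⟩ := exists_nat_one_div_lt (half_pos hε)
  obtain ⟨q, hq, hgood, l, hl⟩ := h.2 c' (max n N)
  refine ⟨q, (le_max_right _ _).trans hq.le, hgood, l, ?_⟩
  have h1 : 1 / (((max n N : ℕ) : ℝ) + 1) ≤ 1 / ((n : ℝ) + 1) := by
    gcongr; exact le_max_left _ _
  simp only at hl
  rw [abs_lt] at hl ⊢
  constructor <;> linarith

/-- The skew product over the rotation which induces the skew product over the interval exchange. -/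
theorem measure_eq_zero_or_compl_of_goodPair {f : ℝ → ℝ} (hf : IsC1AC f)
    (hint : ∫ x in Ico (0 : ℝ) 1, f x = 0) (hlim : Tendsto f (𝓝[<] (1 : ℝ)) (𝓝 (f 0)))
    (hne : f 0 ≠ 0) {p b : ℝ} (hp : 1 < p) [Fact (0 < p)] (hgood : GoodPair (b / p, 1 / p))
    {A : Set (AddCircle p × ℝ)} (hA : MeasurableSet A)
    (hinv : ∀ (y t : ℝ), (((y + b : ℝ) : AddCircle p), t + extPeriodic (zero_lt_one.trans hp) f y) ∈ A ↔
      ((y : AddCircle p), t) ∈ A) : volume A = 0 ∨ volume Aᶜ = 0 := by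
  have hp0 : 0 < p := zero_lt_one.trans hp
  have hden : ∀ q, GoodDenominator p b q ↔ GoodDenominator 1 (b / p) q := fun q => by
    rw [← goodDenominator_mul_iff hp0, div_mul_cancel₀ _ hp0.ne']
  have hinf : ∀ N, ∃ n ≥ N, GoodDenominator p b n := fun N => by
    obtain ⟨q, hq, hq', -⟩ := hgood.exists_denominator 0 one_pos N
    exact ⟨q, hq, (hden q).2 hq'⟩
  have ha : addOrderOf (b : AddCircle p) = 0 := by
    rw [addOrderOf_eq_zero_iff, AddCircle.not_isOfFinAddOrder_iff_forall_rat_ne_div]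
    exact fun r hr => hgood.1 ⟨r, hr⟩
  set F : AddCircle p → ℝ := (extPeriodic_periodic hp0 f).lift with hF
  have hFsum : ∀ (n : ℕ) (y : ℝ), ∑ j ∈ Finset.range n, F ((y : AddCircle p) + j • (b : AddCircle p)) =
      ∑ j ∈ Finset.range n, extPeriodic hp0 f (y + j * b) := by
    intro n y
    refine Finset.sum_congr rfl fun j _ => ?_
    rw [← AddCircle.coe_nsmul, ← AddCircle.coe_add, nsmul_eq_mul]
    rfl
  refine measure_eq_zero_or_compl_of_skewInvariant ha (F := F) hne (fun c => ?_) hA ?_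
  swap
  · intro x t
    obtain ⟨y, rfl⟩ := QuotientAddGroup.mk_surjective x
    exact hinv y t
  -- The relevant integers satisfy `|k - c| ≤ 6 + 1`: the count `N` is within `6` of `q / p`, and `q
  -- / p` is within `1` of `c + l`.
  set K : Finset ℤ := Finset.Icc (⌊c⌋ - 8) (⌈c⌉ + 8) with hK
  have hKne : K.Nonempty := by
    refine ⟨⌊c⌋, Finset.mem_Icc.2 ⟨by omega, ?_⟩⟩
    have := Int.floor_le_ceil c
    omega
  set V : ENNReal := volume (univ : Set (AddCircle p)) with hV
  have hV0 : V ≠ 0 := by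
    rw [hV, AddCircle.measure_univ]; simpa using hp0
  have hVt : V ≠ ⊤ := measure_ne_top _ _
  set δ : ENNReal := V / K.card with hδ
  have hδ0 : δ ≠ 0 := ENNReal.div_ne_zero.2 ⟨hV0, by simp⟩
  -- Pigeonhole: if every `k` failed with its own tolerance, then for one large `q` the finitely
  -- many sets indexed by `K` would cover the circle while each has measure below `V / K.card`.
  by_contra hcon
  push Not at hcon
  choose ε hε hε' using fun k => hcon k δ hδ0
  obtain ⟨k₀, hk₀, hmin⟩ := K.exists_min_image ε hKne
  set e := ε k₀
  have he : 0 < e := hε k₀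
  -- The total error is `e'` from the Birkhoff sum plus `|f 0| * e'` from `q / p`; this choice keeps
  -- it below the smallest tolerance `e`.
  set e' : ℝ := min 1 (e / (2 * (1 + |f 0|))) with he'
  have he'0 : 0 < e' := lt_min one_pos (by positivity)
  have he'1 : e' ≤ 1 := min_le_left _ _
  have he'e : e' + |f 0| * e' < e := by
    have h1 : e' ≤ e / (2 * (1 + |f 0|)) := min_le_right _ _
    rw [le_div_iff₀ (by positivity)] at h1
    linarith
  obtain ⟨Q, hQ⟩ := exists_int_birkhoffSum_extPeriodic hf hint hlim hp hinf he'0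
  obtain ⟨q, hq, hqg, l, hl⟩ := hgood.exists_denominator c he'0 (max Q (⌊p / e⌋₊ + 1))
  have hqg' := (hden q).2 hqg
  have hq0 : (0 : ℝ) < q := by exact_mod_cast hqg.1
  have hsmall : ‖q • (b : AddCircle p)‖ < e := by
    obtain ⟨-, m, -, hm⟩ := hqg'
    have h1 : q • (b : AddCircle p) = ((q * b - m * p : ℝ) : AddCircle p) := by
      rw [AddCircle.coe_sub, ← zsmul_eq_mul, AddCircle.coe_zsmul, AddCircle.coe_period, smul_zero,
        sub_zero, ← nsmul_eq_mul, AddCircle.coe_nsmul]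
    rw [h1]
    refine (QuotientAddGroup.norm_mk_le_norm.trans hm).trans_lt ?_
    have h2 : p / e < q := by
      refine (Nat.lt_floor_add_one _).trans_le ?_
      exact_mod_cast (le_max_right _ _).trans hq
    rw [div_lt_iff₀ he] at h2
    rw [div_lt_iff₀ hq0]; linarith
  have hcover : (univ : Set (AddCircle p)) ⊆ ⋃ k ∈ K,
      {x | |∑ j ∈ Finset.range q, F (x + j • (b : AddCircle p)) - f 0 * (k - c)| < ε k} := by
    intro x _
    obtain ⟨y, rfl⟩ := QuotientAddGroup.mk_surjective x
    obtain ⟨N, hN, hN'⟩ := hQ q ((le_max_left _ _).trans hq) hqg' y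
    have hl' : |q / p - c - l| < e' := by rwa [mul_one_div] at hl
    have hkc : |((N - l : ℤ) : ℝ) - c| ≤ 7 := by
      have e1 : ((N - l : ℤ) : ℝ) - c = (N - q / p) + (q / p - c - l) := by push_cast; ring
      rw [e1]
      exact (abs_add_le _ _).trans (by linarith)
    rw [abs_le] at hkc
    have hkK : N - l ∈ K := by
      refine Finset.mem_Icc.2 ⟨?_, ?_⟩
      · have h1 := Int.floor_le c
        have : ((⌊c⌋ - 8 : ℤ) : ℝ) ≤ ((N - l : ℤ) : ℝ) := by
          rw [Int.cast_sub]; push_cast at hkc ⊢; linarith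
        exact_mod_cast this
      · have h1 := Int.le_ceil c
        have : ((N - l : ℤ) : ℝ) ≤ ((⌈c⌉ + 8 : ℤ) : ℝ) := by
          rw [Int.cast_add]; push_cast at hkc ⊢; linarith
        exact_mod_cast this
    simp only [mem_iUnion, mem_ofPred_eq]
    refine ⟨N - l, hkK, lt_of_lt_of_le ?_ (hmin _ hkK)⟩
    have hs := hFsum q y
    change |∑ j ∈ Finset.range q, F ((y : AddCircle p) + j • (b : AddCircle p)) - _| < _
    rw [hs]
    have e1 : ∑ j ∈ Finset.range q, extPeriodic hp0 f (y + j * b) - f 0 * (((N - l : ℤ) : ℝ) - c) =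
        (∑ j ∈ Finset.range q, extPeriodic hp0 f (y + j * b) - f 0 * (N - q / p)) -
          f 0 * (q / p - c - l) := by push_cast; ring
    rw [e1]
    refine (abs_sub _ _).trans_lt (lt_of_le_of_lt ?_ he'e)
    rw [abs_mul]
    gcongr
  have h1 : V ≤ ∑ k ∈ K, volume
      {x | |∑ j ∈ Finset.range q, F (x + j • (b : AddCircle p)) - f 0 * (k - c)| < ε k} :=
    (measure_mono hcover).trans (measure_biUnion_finset_le _ _)
  have h2 := ENNReal.sum_lt_sum_of_nonempty hKne fun k hk =>
    hε' k q (hsmall.trans_le (hmin k hk))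
  have h3 : ∑ _k ∈ K, δ = V := by
    rw [Finset.sum_const, nsmul_eq_mul, hδ, ENNReal.mul_div_cancel (by simpa using hKne.ne_empty)
      (by simp)]
  exact lt_irrefl _ ((h1.trans_lt h2).trans_le h3.le)

/-! ### Return to the interval exchange -/

instance : IsProbabilityMeasure lebIco := ⟨by
  rw [lebIco, (MeasurableEmbedding.subtype_coe measurableSet_Ico).comap_apply, image_univ,
    Subtype.range_coe, Real.volume_Ico, sub_zero, ENNReal.ofReal_one]⟩

theorem IsC1AC.measurable_restrict {f : ℝ → ℝ} (hf : IsC1AC f) :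
    Measurable fun x : Ico (0 : ℝ) 1 => f x := by
  obtain ⟨g, hg, -⟩ := hf
  have : ContinuousOn f (Ico 0 1) := fun y hy => (hg y hy).continuousWithinAt
  exact (continuousOn_iff_continuous_domRestrict.1 this).measurable

theorem measurable_symIETFun (l : LengthSimplex) : Measurable (symIETFun l) := by
  refine Measurable.ite measurableSet_Iio (by fun_prop)
    (Measurable.ite measurableSet_Iio (by fun_prop) (by fun_prop))

theorem measurable_symIET (l : LengthSimplex) : Measurable (symIET l) :=
  ((measurable_symIETFun l).comp measurable_subtype_coe).subtype_mk

open LengthSimplex in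
theorem measurePreserving_symIET (l : LengthSimplex) :
    MeasurePreserving (symIET l) lebIco lebIco := by
  have hA := lA_pos l
  have hB := lB_pos l
  have hC := lC_pos l
  have hs := sum_eq_one l
  refine ⟨measurable_symIET l, Measure.ext fun s hsm => ?_⟩
  have hemb := MeasurableEmbedding.subtype_coe (measurableSet_Ico (a := (0 : ℝ)) (b := 1))
  rw [Measure.map_apply (measurable_symIET l) hsm, lebIco, hemb.comap_apply, hemb.comap_apply]
  set S : Set ℝ := Subtype.val '' s with hS
  have hSm : MeasurableSet S := hemb.measurableSet_image.2 hsm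
  have hpre : (Subtype.val '' (symIET l ⁻¹' s) : Set ℝ) = Ico 0 1 ∩ symIETFun l ⁻¹' S := by
    ext x
    simp only [hS, mem_image, mem_preimage, Subtype.exists, exists_and_right, exists_eq_right,
      mem_inter_iff]
    constructor
    · rintro ⟨hx, h⟩
      exact ⟨hx, symIETFun_mem l hx, h⟩
    · rintro ⟨hx, _, h⟩
      exact ⟨hx, h⟩
  have hSsub : S ⊆ Ico 0 1 := by rintro _ ⟨x, _, rfl⟩; exact x.2
  have split3 : ∀ (U : Set ℝ) (u v : ℝ), MeasurableSet U → U ⊆ Ico 0 1 → 0 ≤ u → u ≤ v → v ≤ 1 →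
      volume U = volume (U ∩ Ico 0 u) + volume (U ∩ Ico u v) + volume (U ∩ Ico v 1) := by
    intro U u v hU hsub h0 huv hv1
    rw [← measure_union _ (hU.inter measurableSet_Ico), ← measure_union _ (hU.inter measurableSet_Ico),
      ← inter_union_distrib_left, ← inter_union_distrib_left, Ico_union_Ico_eq_Ico h0 huv,
      Ico_union_Ico_eq_Ico (h0.trans huv) hv1, inter_eq_left.2 hsub]
    · rw [disjoint_left]
      rintro x (hx | hx) hx'
      · linarith [hx.2.2, hx'.2.1]
      · linarith [hx.2.2, hx'.2.1]
    · rw [disjoint_left]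
      intro x hx hx'
      linarith [hx.2.2, hx'.2.1]
  have hshift : ∀ (a b u : ℝ) (P : Set ℝ), (∀ x ∈ Ico a b, x ∈ P ↔ x + u ∈ S) →
      volume (P ∩ Ico a b) = volume (S ∩ Ico (a + u) (b + u)) := by
    intro a b u P h
    rw [← measure_preimage_add_right volume u (S ∩ Ico (a + u) (b + u))]
    congr 1
    ext x
    simp only [mem_inter_iff, mem_preimage, mem_Ico, add_le_add_iff_right, add_lt_add_iff_right]
    exact and_congr_left fun hx => h x hx
  rw [hpre]
  set P := Ico (0 : ℝ) 1 ∩ symIETFun l ⁻¹' S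
  have hPm : MeasurableSet P := measurableSet_Ico.inter (measurable_symIETFun l hSm)
  rw [split3 P (lA l) (lA l + lB l) hPm inter_subset_left (by linarith) (by linarith) (by linarith),
    split3 S (lC l) (lC l + lB l) hSm hSsub (by linarith) (by linarith) (by linarith)]
  rw [hshift 0 (lA l) (lC l + lB l) P, hshift (lA l) (lA l + lB l) (lC l - lA l) P,
    hshift (lA l + lB l) 1 (-(lA l + lB l)) P]
  · rw [show 0 + (lC l + lB l) = lC l + lB l by ring, show lA l + (lC l + lB l) = 1 by linarith,
      show lA l + (lC l - lA l) = lC l by ring,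
      show lA l + lB l + (lC l - lA l) = lC l + lB l by ring, add_neg_cancel,
      show 1 + -(lA l + lB l) = lC l by linarith]
    abel
  · intro x hx
    have h1 : ¬ x < lA l := by linarith [hx.1]
    have h2 : ¬ x < lA l + lB l := by linarith [hx.1]
    have hx01 : x ∈ Ico (0 : ℝ) 1 := ⟨by linarith [hx.1], by linarith [hx.2]⟩
    simp only [P, mem_inter_iff, hx01, true_and, mem_preimage, symIETFun, h1, h2, if_false, sub_eq_add_neg]
  · intro x hx
    have h1 : ¬ x < lA l := by linarith [hx.1]
    have hx01 : x ∈ Ico (0 : ℝ) 1 := ⟨by linarith [hx.1], by linarith [hx.2]⟩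
    simp only [P, mem_inter_iff, hx01, true_and, mem_preimage, symIETFun, h1, hx.2, if_false, if_true,
      add_sub_assoc]
  · intro x hx
    have hx01 : x ∈ Ico (0 : ℝ) 1 := ⟨by linarith [hx.1], by linarith [hx.2]⟩
    simp only [P, mem_inter_iff, hx01, true_and, mem_preimage, symIETFun, hx.2, if_true]

theorem measurePreserving_skewProduct {X : Type*} [MeasurableSpace X] {T : X → X} {μ : Measure X}
    [SFinite μ] (hT : MeasurePreserving T μ μ) {f : X → ℝ} (hf : Measurable f) :
    MeasurePreserving (skewProduct T f) (μ.prod volume) (μ.prod volume) :=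
  hT.skew_product (g := fun x t => t + f x) (by unfold Function.uncurry; fun_prop)
    (ae_of_all _ fun x => (measurePreserving_add_right volume (f x)).map_eq)

/-- A transfer function `g` makes `t - g x` invariant, hence constant almost everywhere; on almost
every vertical line this would confine almost every `t` to a single point. -/
theorem not_isCoboundary_of_ergodic {X : Type*} [MeasurableSpace X] {T : X → X} {μ : Measure X}
    [SFinite μ] [NeZero μ] {f : X → ℝ} (h : Ergodic (skewProduct T f) (μ.prod volume)) :
    ¬ IsCoboundary T μ f := by
  rintro ⟨g, hg, hfg⟩
  obtain ⟨c, hc⟩ := h.ae_eq_const_of_ae_eq_comp_ae (g := fun z => z.2 - g z.1)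
    ((measurable_snd.aemeasurable.sub (hg.comp_quasiMeasurePreserving
      Measure.quasiMeasurePreserving_fst)).aestronglyMeasurable) (by
      filter_upwards [Measure.quasiMeasurePreserving_fst.ae hfg] with z hz
      simp only [Function.comp_apply, skewProduct]
      rw [hz]; ring)
  have h2 := Measure.ae_ae_of_ae_prod hc
  obtain ⟨x, hx⟩ := h2.exists
  have h3 : ∀ᵐ t : ℝ, t = c + g x := by
    filter_upwards [hx] with t ht
    simp only [Function.const_apply] at ht
    linarith
  rw [ae_iff] at h3
  have h4 : volume ({c + g x}ᶜ : Set ℝ) = 0 := h3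
  have h5 : volume (univ : Set ℝ) = 0 := by
    rw [← union_compl_self ({c + g x} : Set ℝ)]
    exact measure_union_null (measure_singleton _) h4
  simp at h5

open LengthSimplex in
theorem ergodic_skewProduct_symIET {f : ℝ → ℝ} (hf : IsC1AC f)
    (hint : ∫ x in Ico (0 : ℝ) 1, f x = 0) (hlim : Tendsto f (𝓝[<] (1 : ℝ)) (𝓝 (f 0)))
    (hne : f 0 ≠ 0) {l : LengthSimplex}
    (hgood : GoodPair ((lB l + lC l) / (1 + lB l), 1 / (1 + lB l))) :
    Ergodic (skewProduct (symIET l) (fun x : Ico (0 : ℝ) 1 => f x))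
      (lebIco.prod (volume : Measure ℝ)) := by
  have hA := lA_pos l
  have hB := lB_pos l
  have hC := lC_pos l
  have hsum := sum_eq_one l
  refine { measurePreserving_skewProduct (measurePreserving_symIET l) hf.measurable_restrict with
    aeconst_set := fun s hs hinv => ?_ }
  set p := 1 + lB l with hp_def
  have hp : 1 < p := by linarith
  have hp0 : 0 < p := zero_lt_one.trans hp
  have : Fact (0 < p) := ⟨hp0⟩
  have hembI := MeasurableEmbedding.subtype_coe (measurableSet_Ico (a := (0 : ℝ)) (b := 1))
  have hemb : MeasurableEmbedding (Prod.map Subtype.val id : Ico (0 : ℝ) 1 × ℝ → ℝ × ℝ) :=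
    hembI.prodMap MeasurableEmbedding.id
  set S : Set (ℝ × ℝ) := Prod.map Subtype.val id '' s with hS
  have hSm : MeasurableSet S := hemb.measurableSet_image.2 hs
  have hmemS : ∀ (x : Ico (0 : ℝ) 1) t, ((x : ℝ), t) ∈ S ↔ (x, t) ∈ s := fun x t =>
    hemb.injective.mem_set_image (a := (x, t))
  have hSinv : ∀ y ∈ Ico (0 : ℝ) 1, ∀ t, (symIETFun l y, t + f y) ∈ S ↔ (y, t) ∈ S := by
    intro y hy t
    have h1 := hmemS (symIET l ⟨y, hy⟩) (t + f y)
    have h2 := hmemS ⟨y, hy⟩ t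
    have h3 : (symIET l ⟨y, hy⟩, t + f y) ∈ s ↔ ((⟨y, hy⟩ : Ico (0 : ℝ) 1), t) ∈ s := by
      conv_rhs => rw [← hinv]
      rfl
    exact h1.trans (h3.trans h2.symm)
  -- A point of the gap `[1, p)` is represented by its image under one more rotation step, which
  -- lies in `[0, 1)`. The extended function vanishes on the gap, so the fibre coordinate is
  -- unchanged.
  set R : ℝ → ℝ := fun y => if y < 1 then y else y - (lA l + lB l) with hR
  have hRm : Measurable R := Measurable.ite measurableSet_Iio (by fun_prop) (by fun_prop)
  set A : Set (AddCircle p × ℝ) :=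
    (fun z => (R (AddCircle.equivIco p 0 z.1), z.2)) ⁻¹' S with hAdef
  have hAm : MeasurableSet A := by
    refine Measurable.prodMk ?_ measurable_snd hSm
    exact hRm.comp (measurable_subtype_coe.comp
      ((AddCircle.measurableEquivIco p 0).measurable.comp measurable_fst))
  have hmemA : ∀ y ∈ Ico 0 p, ∀ t, (((y : ℝ) : AddCircle p), t) ∈ A ↔ (R y, t) ∈ S := by
    intro y hy t
    simp only [hAdef, mem_preimage]
    rw [AddCircle.equivIco_coe_of_mem (by simpa using hy)]
  have hAinv : ∀ y t : ℝ, (((y + (lB l + lC l) : ℝ) : AddCircle p), t + extPeriodic hp0 f y) ∈ A ↔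
      ((y : AddCircle p), t) ∈ A := by
    have key : ∀ y ∈ Ico 0 p, ∀ t : ℝ,
        (((y + (lB l + lC l) : ℝ) : AddCircle p), t + extPeriodic hp0 f y) ∈ A ↔
        ((y : AddCircle p), t) ∈ A := by
      intro y hy t
      rw [hmemA y hy, extPeriodic, toIcoMod_of_mem hp0 hy]
      -- Rotation by `lB + lC` is rotation by `-(lA + lB)`, as the two differ by the period `1 +
      -- lB`.
      have hred : ((y + (lB l + lC l) : ℝ) : AddCircle p) = ((y - (lA l + lB l) : ℝ) : AddCircle p) := by
        rw [← AddCircle.coe_add_period p (y - (lA l + lB l))]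
        congr 1
        rw [hp_def]; linarith
      by_cases h1 : y < 1
      · have hy1 : y ∈ Ico (0 : ℝ) 1 := ⟨hy.1, h1⟩
        have hRy : R y = y := if_pos h1
        rw [if_pos h1, hRy, ← hSinv y hy1 t]
        by_cases h2 : y < lA l
        · rw [hmemA _ ⟨by linarith [hy.1], by linarith⟩]
          have e1 : R (y + (lB l + lC l)) = y + (lB l + lC l) := if_pos (by linarith)
          rw [e1, symIETFun, if_pos h2, add_comm (lC l)]
        -- Points of `B` land in the gap and need the second step hidden in `R`; points of `C`
        -- return at once.
        · by_cases h3 : y < lA l + lB l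
          · rw [hmemA _ ⟨by linarith [hy.1], by linarith⟩]
            have e1 : R (y + (lB l + lC l)) = y + (lB l + lC l) - (lA l + lB l) :=
              if_neg (by linarith)
            rw [e1, symIETFun, if_neg h2, if_pos h3,
              show y + (lB l + lC l) - (lA l + lB l) = y + lC l - lA l by ring]
          · rw [hred, hmemA _ ⟨by linarith, by linarith⟩]
            have e1 : R (y - (lA l + lB l)) = y - (lA l + lB l) := if_pos (by linarith)
            rw [e1, symIETFun, if_neg h2, if_neg h3]
      · have hy2 := hy.2
        rw [if_neg h1, add_zero, hred, hmemA _ ⟨by linarith, by linarith⟩]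
        have e1 : R (y - (lA l + lB l)) = y - (lA l + lB l) := if_pos (by linarith)
        have e2 : R y = y - (lA l + lB l) := if_neg h1
        rw [e1, e2]
    intro y t
    have hk := key (toIcoMod hp0 0 y) (by simpa using toIcoMod_mem_Ico hp0 0 y) t
    have hcoe : ((toIcoMod hp0 0 y : ℝ) : AddCircle p) = y :=
      AddCircle.coe_equivIco (p := p) (a := (0 : ℝ)) (y := (y : AddCircle p))
    have hext : extPeriodic hp0 f (toIcoMod hp0 0 y) = extPeriodic hp0 f y := by
      simp [extPeriodic]
    rwa [hext, AddCircle.coe_add, hcoe, ← AddCircle.coe_add] at hk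
  set ι : Ico (0 : ℝ) 1 × ℝ → AddCircle p × ℝ :=
    Prod.map (fun x => ((x : ℝ) : AddCircle p)) id with hι
  have hιA : ι ⁻¹' A = s := by
    ext ⟨x, t⟩
    have hR1 : R x = x := if_pos x.2.2
    have h1 := hmemA x ⟨x.2.1, x.2.2.trans hp⟩ t
    rw [hR1] at h1
    exact h1.trans (hmemS x t)
  have hcoe_meas : Measurable fun x : Ico (0 : ℝ) 1 => ((x : ℝ) : AddCircle p) :=
    AddCircle.measurable_mk'.comp measurable_subtype_coe
  have hac : Measure.map (fun x : Ico (0 : ℝ) 1 => ((x : ℝ) : AddCircle p)) lebIco ≪ volume := by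
    have h1 : Measure.map (fun x : Ico (0 : ℝ) 1 => ((x : ℝ) : AddCircle p)) lebIco =
        Measure.map (fun y : ℝ => (y : AddCircle p)) (volume.restrict (Ico 0 1)) := by
      rw [← map_comap_subtype_coe measurableSet_Ico,
        Measure.map_map AddCircle.measurable_mk' measurable_subtype_coe]
      rfl
    rw [h1, ← (AddCircle.measurePreserving_mk p 0).map_eq]
    refine Measure.AbsolutelyContinuous.map ?_ AddCircle.measurable_mk'
    rw [← restrict_Ico_eq_restrict_Ioc, zero_add]
    exact Measure.absolutelyContinuous_of_le
      (Measure.restrict_mono (Ico_subset_Ico_right hp.le) le_rfl)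
  -- Only transfer of null sets is needed: a null or conull set over the circle pulls back to one
  -- over `[0, 1)`.
  have hq : Measure.QuasiMeasurePreserving ι (lebIco.prod volume) volume := by
    refine ⟨hcoe_meas.prodMap measurable_id, ?_⟩
    rw [hι, ← Measure.map_prod_map _ _ hcoe_meas measurable_id, Measure.map_id]
    exact hac.prod Measure.AbsolutelyContinuous.rfl
  rw [eventuallyConst_set', ← hιA]
  rcases measure_eq_zero_or_compl_of_goodPair hf hint hlim hne hp hgood hAm hAinv with h | h
  · exact Or.inl (ae_eq_empty.2 (hq.preimage_null h))
  · exact Or.inr (ae_eq_univ.2 (hq.preimage_null h))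

end

theorem theorem1p2 (f : ℝ → ℝ) (hf : IsC1AC f)
    (hint : ∫ x in Ico (0 : ℝ) 1, f x = 0)
    (hlim : Tendsto f (𝓝[<] (1 : ℝ)) (𝓝 (f 0)))
    (hne : f 0 ≠ 0) :
    ∀ᵐ l ∂lebSimplex,
      Ergodic (skewProduct (symIET l) (fun x : Ico (0 : ℝ) 1 => f x))
        (lebIco.prod (volume : Measure ℝ)) ∧
      ¬ IsCoboundary (symIET l) lebIco (fun x : Ico (0 : ℝ) 1 => f x) := by
  filter_upwards [ae_goodPair_lebSimplex] with l hl
  have h := ergodic_skewProduct_symIET hf hint hlim hne hl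
  exact ⟨h, not_isCoboundary_of_ergodic h⟩
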